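/- Let $p$ be a prime number, $d\ge 1$ and $q=p^d$. For a profinite group $G$ and $r\ge 0$ let $H^r(G)=H^r(G,\mathbb{Z}/q)$ be the continuous cohomology of $G$ with coefficients in the discrete module $\mathbb{Z}/q$ with trivial action, and let $H^*(G)=\bigoplus_{r\ge 0}H^r(G)$ be the graded cohomology ring with the cup product; it is a graded-commutative $\mathbb{Z}/q$-algebra. Let $G^{(1)}=G$ and let $G^{(i+1)}=(G^{(i)})^q[G^{(i)},G]$ be the closed subgroup topologically generated by all $h^q$ and all $h^{-1}g^{-1}hg$ with $h\in G^{(i)}$, $g\in G$; put $G^{[i]}=G/G^{(i)}$. For $\mathcal{A}=\bigoplus_{r\ge0}A_r$ a graded $\mathbb{Z}/q$-algebra of the form $H^*(G)$: - $A_{\mathrm{dec},r}$ is the submodule of $A_r$ generated by all products of $r$ elements of $A_1$ (for $r=0$: generated by $1$), and $\mathcal{A}_{\mathrm{dec}}=\bigoplus_r A_{\mathrm{dec},r}$. One says that $A_r$ is *decomposable* if $A_r=A_{\mathrm{dec},r}$. - The *quadratic hull* of $\mathcal{A}$ is $\hat{\mathcal{A}}=\bigoplus_{r\ge0}A_1^{\otimes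 r}/T_r$, where $T_r$ is the submodule of $A_1^{\otimes r}$ generated by all $a_1\otimes\cdots\otimes a_r$ such that $a_ia_j=0$ in $A_2$ for some $i\ne j$, with the multiplication induced by the tensor product. - $\mathcal{A}$ is *quadratic* if the canonical epimorphism $\omega_{\mathcal{A}}\colon\hat{\mathcal{A}}\to\mathcal{A}_{\mathrm{dec}}$, the identity in degree $1$, is an isomorphism. Let $\pi\colon G_1\to G_2$ be a continuous homomorphism of profinite groups. Assume that $H^*(G_1)$ is quadratic and that $H^2(G_2)$ is decomposable. Write $\pi^*_r\colon H^r(G_2)\to H^r(G_1)$ for the induced homomorphisms, $\pi^{[3]}\colon G_1^{[3]}\to G_2^{[3]}$ for the homomorphism induced by $\pi$, and $\widehat{\pi^*}\colon\widehat{H^*(G_2)}\to\widehat{H^*(G_1)}$ and $\pi^*_{\mathrm{dec}}\colon H^*(G_2)_{\mathrm{dec}}\to H^*(G_1)_{\mathrm{dec}}$ for the graded algebra homomorphisms induced by $\pi^*$. Then the following conditions are equivalent: (a) $\pi^*_1$ is bijective and $\pi^*_2$ is injective; (b) $\pi^{[3]}$ is an isomorphism (of profinite groups); (c) $\widehat{\pi^*}$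 is an isomorphism; (d) $\pi^*_{\mathrm{dec}}$ is an isomorphism. -/

import Mathlib

set_option linter.unusedSectionVars false

noncomputable section

namespace QuadCoh

section Cohomology

variable (R : Type*) [CommRing R]
variable (G : Type*) [Group G] [TopologicalSpace G]

/-- Continuous inhomogeneous `n`-cochains `G^n → R`, where `R` is discrete with trivial action
(continuous maps to a discrete space are the locally constant ones). -/
abbrev Cochain (n : ℕ) : Type _ := LocallyConstant (Fin n → G) R

variable {G} in
/-- `(x_1, …, x_k) ↦ (x_1, …, x_m)`, for `k = m + n`. -/
def front {m n k : ℕ} (h : m + n = k) : C(Fin k → G, Fin m → G) :=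
  ⟨fun x i => x ⟨i, by omega⟩, by fun_prop⟩

variable {G} in
/-- `(x_1, …, x_k) ↦ (x_{m+1}, …, x_k)`, for `k = m + n`. -/
def back {m n k : ℕ} (h : m + n = k) : C(Fin k → G, Fin n → G) :=
  ⟨fun x i => x ⟨m + i, by omega⟩, by fun_prop⟩

/-- `(x_0, …, x_n) ↦ (x_1, …, x_n)`. -/
def dropFirst (n : ℕ) : C(Fin (n + 1) → G, Fin n → G) :=
  ⟨fun x i => x i.succ, by fun_prop⟩

variable [IsTopologicalGroup G]

/-- `(x_0, …, x_n) ↦ (x_0, …, x_j x_{j+1}, …, x_n)` for `j < n`, and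
`(x_0, …, x_n) ↦ (x_0, …, x_{n-1})` for `j = n`. -/
def contract (n : ℕ) (j : Fin (n + 1)) : C(Fin (n + 1) → G, Fin n → G) :=
  ⟨fun x => Fin.contractNth j (· * ·) x, by
    refine continuous_pi fun k => ?_
    unfold Fin.contractNth
    split_ifs <;> fun_prop⟩

/-- The coboundary `(d f)(x_0, …, x_n) = f(x_1, …, x_n) + ∑_{j < n} (-1)^(j+1)
f(x_0, …, x_j x_{j+1}, …, x_n) + (-1)^(n+1) f(x_0, …, x_{n-1})`, as in `groupCohomology`. -/
def d (n : ℕ) : Cochain R G n →ₗ[R] Cochain R G (n + 1) :=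
  LocallyConstant.comapₗ R (dropFirst G n) +
    ∑ j : Fin (n + 1), (-1 : R) ^ ((j : ℕ) + 1) • LocallyConstant.comapₗ R (contract G n j)

theorem d_apply (n : ℕ) (f : Cochain R G n) (x : Fin (n + 1) → G) :
    d R G n f x = f (fun i => x i.succ) +
      ∑ j : Fin (n + 1), (-1 : R) ^ ((j : ℕ) + 1) * f (Fin.contractNth j (· * ·) x) := by
  have key : ∀ s : Finset (Fin (n + 1)), (∑ j ∈ s, (-1 : R) ^ ((j : ℕ) + 1) •
      LocallyConstant.comapₗ R (contract G n j) : Cochain R G n →ₗ[R] Cochain R G (n + 1)) f x =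
      ∑ j ∈ s, (-1 : R) ^ ((j : ℕ) + 1) * f (Fin.contractNth j (· * ·) x) := by
    intro s
    classical
    induction s using Finset.induction_on with
    | empty => simp
    | insert a s ha ih =>
      rw [Finset.sum_insert ha, Finset.sum_insert ha, ← ih]
      rfl
  rw [← key]
  rfl

/-- Continuous `n`-cocycles. -/
def cocycles (n : ℕ) : Submodule R (Cochain R G n) := LinearMap.ker (d R G n)

/-- Continuous `n`-coboundaries. -/
def coboundaries : (n : ℕ) → Submodule R (Cochain R G n)
  | 0 => ⊥
  | n + 1 => LinearMap.range (d R G n)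

/-- The continuous cohomology group `H^n(G) = H^n(G, R)` with trivial action on the discrete
module `R`. (Mathlib's `continuousCohomology` has no cup product, hence the explicit cochains.) -/
def H (n : ℕ) : Type _ := cocycles R G n ⧸ (coboundaries R G n).submoduleOf (cocycles R G n)

instance (n : ℕ) : AddCommGroup (H R G n) :=
  inferInstanceAs (AddCommGroup (cocycles R G n ⧸ (coboundaries R G n).submoduleOf _))

instance (n : ℕ) : Module R (H R G n) :=
  inferInstanceAs (Module R (cocycles R G n ⧸ (coboundaries R G n).submoduleOf _))

/-- The cohomology class of a cocycle. -/
def H.mk (n : ℕ) : cocycles R G n →ₗ[R] H R G n :=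
  ((coboundaries R G n).submoduleOf (cocycles R G n)).mkQ

variable {R G}

theorem H.mk_surjective {n : ℕ} : Function.Surjective (H.mk R G n) :=
  Submodule.mkQ_surjective _

theorem H.mk_eq_mk {n : ℕ} {a b : cocycles R G n} :
    H.mk R G n a = H.mk R G n b ↔ (a : Cochain R G n) - b ∈ coboundaries R G n := by
  exact Submodule.Quotient.eq ((coboundaries R G n).submoduleOf (cocycles R G n))

/-- Cup product on cochains:
`(f ∪ g)(x_1, …, x_{m+n}) = f(x_1, …, x_m) g(x_{m+1}, …, x_{m+n})`. -/
def cup {m n k : ℕ} (h : m + n = k) (f : Cochain R G m) (g : Cochain R G n) : Cochain R G k :=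
  f.comap (front h) * g.comap (back h)

theorem cup_apply {m n k : ℕ} (h : m + n = k) (f : Cochain R G m) (g : Cochain R G n)
    (x : Fin k → G) :
    cup h f g x = f (fun i => x ⟨i, by omega⟩) * g (fun i => x ⟨m + i, by omega⟩) := rfl

theorem d_cup {m n k : ℕ} (h : m + n = k) (f : Cochain R G m) (g : Cochain R G n) :
    d R G k (cup h f g) = cup (by omega : (m + 1) + n = k + 1) (d R G m f) g +
      (-1 : R) ^ m • cup (by omega : m + (n + 1) = k + 1) f (d R G n g) := by
  subst h
  ext x
  simp only [LocallyConstant.coe_add, Pi.add_apply, LocallyConstant.coe_smul, Pi.smul_apply,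
    smul_eq_mul, cup_apply, d_apply]
  have hs : ∀ F : Fin (m + n + 1) → R, ∑ j, F j = (∑ j : Fin m, F ⟨j, by omega⟩) +
      ∑ j : Fin (n + 1), F ⟨m + j, by omega⟩ := by
    intro F
    exact Fin.sum_univ_add (a := m) (b := n + 1) F
  rw [hs, Fin.sum_univ_castSucc (n := m)]
  have e1 : ∀ j : Fin m, (fun i : Fin m => Fin.contractNth (⟨j, by omega⟩ : Fin (m + n + 1))
      (· * ·) x ⟨i, by omega⟩) = Fin.contractNth j.castSucc (· * ·)
        (fun i : Fin (m + 1) => x ⟨i, by omega⟩) := by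
    intro j; ext i
    simp [Fin.contractNth]
  have e2 : ∀ j : Fin m, (fun i : Fin n => Fin.contractNth (⟨j, by omega⟩ : Fin (m + n + 1))
      (· * ·) x ⟨m + i, by omega⟩) = (fun i : Fin n => x ⟨m + 1 + i, by omega⟩) := by
    intro j; ext i
    have h1 : ¬ (m + (i : ℕ) < j) := by omega
    have h2 : ¬ (m + (i : ℕ) = j) := by omega
    simp only [Fin.contractNth, h1, h2, if_false]
    congr 1; ext; simp; omega
  have e3 : ∀ j : Fin (n + 1), (fun i : Fin m => Fin.contractNth
      (⟨m + j, by omega⟩ : Fin (m + n + 1)) (· * ·) x ⟨i, by omega⟩) =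
      (fun i : Fin m => x ⟨i, by omega⟩) := by
    intro j; ext i
    have h1 : (i : ℕ) < m + j := by omega
    simp only [Fin.contractNth, h1, if_true]
    rfl
  have e4 : ∀ j : Fin (n + 1), (fun i : Fin n => Fin.contractNth
      (⟨m + j, by omega⟩ : Fin (m + n + 1)) (· * ·) x ⟨m + i, by omega⟩) =
      Fin.contractNth j (· * ·) (fun i : Fin (n + 1) => x ⟨m + i, by omega⟩) := by
    intro j; ext i
    simp only [Fin.contractNth, add_lt_add_iff_left, add_right_inj]
    rfl
  have e5 : Fin.contractNth (Fin.last m) (· * ·) (fun i : Fin (m + 1) => x ⟨i, by omega⟩) =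
      (fun i : Fin m => x ⟨i, by omega⟩) := by
    ext i
    simp [Fin.contractNth]
  have e6 : (fun i : Fin n => x (⟨m + i, by omega⟩ : Fin (m + n)).succ) =
      (fun i : Fin n => x ⟨m + 1 + i, by omega⟩) := by
    ext i; congr 1; ext; simp; omega
  have e7 : (fun i : Fin n => x ⟨m + (i.succ : Fin (n+1)), by omega⟩) =
      (fun i : Fin n => x ⟨m + 1 + i, by omega⟩) := by
    ext i; congr 1; ext; simp; omega
  simp only [e1, e2, e3, e4, e5, e6, e7, Fin.val_last, Fin.val_castSucc]
  have e8 : (fun i : Fin m => x (⟨i, by omega⟩ : Fin (m + n)).succ) =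
    (fun i : Fin m => x ⟨(i.succ : Fin (m+1)), by omega⟩) := rfl
  rw [e8]
  simp only [add_mul, mul_add, Finset.sum_mul, Finset.mul_sum]
  have e9 : ∀ j : Fin (n + 1), (-1 : R) ^ (m + (j : ℕ) + 1) = (-1) ^ m * (-1) ^ ((j : ℕ) + 1) := by
    intro j; ring
  simp only [e9]
  have e10 : (-1 : R) ^ (m + 1) = - (-1) ^ m := by ring
  rw [e10]
  simp only [mul_assoc, mul_left_comm]
  ring

theorem cup_mem_cocycles {m n k : ℕ} (h : m + n = k) {f : Cochain R G m} {g : Cochain R G n}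
    (hf : f ∈ cocycles R G m) (hg : g ∈ cocycles R G n) : cup h f g ∈ cocycles R G k := by
  have hf' : d R G m f = 0 := hf
  have hg' : d R G n g = 0 := hg
  change d R G k (cup h f g) = 0
  rw [d_cup, hf', hg']
  ext x; simp [cup_apply]

theorem cup_sub_left {m n k : ℕ} (h : m + n = k) (f f' : Cochain R G m) (g : Cochain R G n) :
    cup h (f - f') g = cup h f g - cup h f' g := by
  ext x; exact sub_mul _ _ _

theorem cup_sub_right {m n k : ℕ} (h : m + n = k) (f : Cochain R G m) (g g' : Cochain R G n) :
    cup h f (g - g') = cup h f g - cup h f g' := by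
  ext x; exact mul_sub _ _ _

theorem cup_mem_coboundaries_left {m n k : ℕ} (h : m + n = k) {f : Cochain R G m}
    {g : Cochain R G n} (hf : f ∈ coboundaries R G m) (hg : g ∈ cocycles R G n) :
    cup h f g ∈ coboundaries R G k := by
  have hg' : d R G n g = 0 := hg
  cases m with
  | zero =>
    have hf' : f = 0 := hf
    have : cup h f g = 0 := by rw [hf']; ext x; simp [cup]
    rw [this]; exact zero_mem _
  | succ m =>
    obtain ⟨k, rfl⟩ : ∃ k', k = k' + 1 := ⟨m + n, by omega⟩
    obtain ⟨c, rfl⟩ := hf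
    refine ⟨cup (by omega : m + n = k) c g, ?_⟩
    rw [d_cup, hg']
    ext x; simp [cup]

theorem cup_mem_coboundaries_right {m n k : ℕ} (h : m + n = k) {f : Cochain R G m}
    {g : Cochain R G n} (hf : f ∈ cocycles R G m) (hg : g ∈ coboundaries R G n) :
    cup h f g ∈ coboundaries R G k := by
  have hf' : d R G m f = 0 := hf
  cases n with
  | zero =>
    have hg' : g = 0 := hg
    have : cup h f g = 0 := by rw [hg']; ext x; simp [cup]
    rw [this]; exact zero_mem _
  | succ n =>
    obtain ⟨k, rfl⟩ : ∃ k', k = k' + 1 := ⟨m + n, by omega⟩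
    obtain ⟨c, rfl⟩ := hg
    refine ⟨(-1 : R) ^ m • cup (by omega : m + n = k) f c, ?_⟩
    rw [map_smul, d_cup, hf', smul_add, smul_smul, ← mul_pow]
    ext x; simp [cup]

/-- Cup product on cohomology. -/
def H.mul {m n : ℕ} : H R G m → H R G n → H R G (m + n) :=
  Quotient.map₂ (fun f g => ⟨cup rfl f.1 g.1, cup_mem_cocycles rfl f.2 g.2⟩) (by
    intro a a' ha b b' hb
    rw [← Quotient.eq_iff_equiv] at ha hb ⊢
    have ha' := H.mk_eq_mk.1 ha
    have hb' := H.mk_eq_mk.1 hb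
    refine H.mk_eq_mk.2 ?_
    have : cup rfl a.1 b.1 - cup rfl a'.1 b'.1 =
        cup rfl (a.1 - a'.1) b.1 + cup (rfl : m + n = m + n) a'.1 (b.1 - b'.1) := by
      rw [cup_sub_left, cup_sub_right]; abel
    change cup rfl a.1 b.1 - cup rfl a'.1 b'.1 ∈ _
    rw [this]
    exact add_mem (cup_mem_coboundaries_left _ ha' b.2) (cup_mem_coboundaries_right _ a'.2 hb'))

theorem const_mem_cocycles (r : R) :
    (LocallyConstant.const (Fin 0 → G) r : Cochain R G 0) ∈ cocycles R G 0 := by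
  change d R G 0 _ = 0
  ext x
  simp [d_apply]

/-- The class of the constant `0`-cochain `r`. -/
def H.const (r : R) : H R G 0 := H.mk R G 0 ⟨LocallyConstant.const _ r, const_mem_cocycles r⟩

theorem H.sigma_mk_eq {m n : ℕ} (h : m = n) (f : cocycles R G m) (g : cocycles R G n)
    (hfg : ∀ x : Fin n → G, f.1 (fun i => x ⟨i, by omega⟩) = g.1 x) :
    GradedMonoid.mk (A := H R G) m (H.mk R G m f) = GradedMonoid.mk n (H.mk R G n g) := by
  subst h
  congr 2
  ext x
  exact hfg x

instance : GradedMonoid.GMul (H R G) where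
  mul a b := H.mul a b

theorem H.mk_mul_mk {m n : ℕ} (f : cocycles R G m) (g : cocycles R G n) :
    GradedMonoid.GMul.mul (H.mk R G m f) (H.mk R G n g) =
      H.mk R G (m + n) ⟨cup rfl f.1 g.1, cup_mem_cocycles rfl f.2 g.2⟩ := rfl

instance : GradedMonoid.GOne (H R G) where
  one := H.const 1

instance : DirectSum.GRing (H R G) where
  mul_zero a := by
    obtain ⟨a, rfl⟩ := H.mk_surjective a
    rw [← map_zero (H.mk R G _), H.mk_mul_mk]
    refine congrArg (H.mk R G _) ?_
    ext x; simp [cup_apply]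
  zero_mul a := by
    obtain ⟨a, rfl⟩ := H.mk_surjective a
    rw [← map_zero (H.mk R G _), H.mk_mul_mk]
    refine congrArg (H.mk R G _) ?_
    ext x; simp [cup_apply]
  mul_add a b c := by
    obtain ⟨a, rfl⟩ := H.mk_surjective a
    obtain ⟨b, rfl⟩ := H.mk_surjective b
    obtain ⟨c, rfl⟩ := H.mk_surjective c
    rw [← map_add, H.mk_mul_mk, H.mk_mul_mk, H.mk_mul_mk, ← map_add]
    refine congrArg (H.mk R G _) ?_
    ext x; simp [cup_apply, mul_add]
  add_mul a b c := by
    obtain ⟨a, rfl⟩ := H.mk_surjective a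
    obtain ⟨b, rfl⟩ := H.mk_surjective b
    obtain ⟨c, rfl⟩ := H.mk_surjective c
    rw [← map_add, H.mk_mul_mk, H.mk_mul_mk, H.mk_mul_mk, ← map_add]
    refine congrArg (H.mk R G _) ?_
    ext x; simp [cup_apply, add_mul]
  one_mul := by
    rintro ⟨n, a⟩
    obtain ⟨a, rfl⟩ := H.mk_surjective a
    refine H.sigma_mk_eq (zero_add n) _ _ fun x => ?_
    simp [cup_apply]
  mul_one := by
    rintro ⟨n, a⟩
    obtain ⟨a, rfl⟩ := H.mk_surjective a
    refine H.sigma_mk_eq (add_zero n) _ _ fun x => ?_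
    simp [cup_apply]
  mul_assoc := by
    rintro ⟨m, a⟩ ⟨n, b⟩ ⟨k, c⟩
    obtain ⟨a, rfl⟩ := H.mk_surjective a
    obtain ⟨b, rfl⟩ := H.mk_surjective b
    obtain ⟨c, rfl⟩ := H.mk_surjective c
    refine H.sigma_mk_eq (add_assoc m n k) _ _ fun x => ?_
    simp only [cup_apply, mul_assoc]
    refine congrArg₂ (· * ·) rfl (congrArg₂ (· * ·) rfl (congrArg c.1 ?_))
    funext i
    exact congrArg x (Fin.ext (add_assoc m n i))
  natCast n := H.const (n : R)
  natCast_zero := by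
    rw [← map_zero (H.mk R G _)]
    refine congrArg (H.mk R G 0) ?_
    ext x; simp
  natCast_succ n := by
    refine (congrArg (H.mk R G 0) ?_).trans (map_add (H.mk R G 0) _ _)
    ext x; simp
  intCast n := H.const (n : R)
  intCast_ofNat n := by
    refine congrArg (H.mk R G 0) ?_
    ext x; simp
  intCast_negSucc_ofNat n := by
    refine (congrArg (H.mk R G 0) ?_).trans (map_neg (H.mk R G 0) _)
    ext x; simp

instance : DirectSum.GAlgebra R (H R G) where
  toFun :=
    { toFun := H.const
      map_zero' := by
        rw [← map_zero (H.mk R G _)]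
        refine congrArg (H.mk R G 0) ?_
        ext x; simp
      map_add' := fun r s => by
        refine (congrArg (H.mk R G 0) ?_).trans (map_add (H.mk R G 0) _ _)
        ext x; simp }
  map_one := rfl
  map_mul r s := by
    refine H.sigma_mk_eq (zero_add 0).symm _ _ fun x => ?_
    simp [cup_apply]
  commutes := by
    rintro r ⟨n, a⟩
    obtain ⟨a, rfl⟩ := H.mk_surjective a
    refine H.sigma_mk_eq (show 0 + n = n + 0 by omega) _ _ fun x => ?_
    change r * a.1 _ = a.1 _ * r
    rw [mul_comm]
    refine congrArg₂ (· * ·) (congrArg a.1 ?_) rfl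
    funext i
    exact congrArg x (Fin.ext (zero_add (i : ℕ)))
  smul_def := by
    rintro r ⟨n, a⟩
    obtain ⟨a, rfl⟩ := H.mk_surjective a
    change GradedMonoid.mk n (r • H.mk R G n a) = _
    rw [← map_smul]
    refine H.sigma_mk_eq (zero_add n).symm _ _ fun x => ?_
    change r * a.1 _ = r * a.1 _
    refine congrArg₂ (· * ·) rfl (congrArg a.1 ?_)
    funext i
    exact congrArg x (Fin.ext (zero_add (i : ℕ)).symm)


/-- A cocycle of degree one is a homomorphism. -/
theorem cocycles_one_apply {a : Cochain R G 1} (ha : a ∈ cocycles R G 1) (x y : G) :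
    a (fun _ => x * y) = a (fun _ => x) + a (fun _ => y) := by
  have h : d R G 1 a ![x, y] = 0 := by rw [show d R G 1 a = 0 from ha]; rfl
  rw [d_apply, Fin.sum_univ_two] at h
  have h1 : (fun i : Fin 1 => (![x, y] : Fin 2 → G) i.succ) = fun _ => y := by
    ext i; fin_cases i; rfl
  have h2 : Fin.contractNth (0 : Fin 2) (· * ·) (![x, y] : Fin 2 → G) = fun _ => x * y := by
    ext i; fin_cases i; simp [Fin.contractNth]
  have h3 : Fin.contractNth (1 : Fin 2) (· * ·) (![x, y] : Fin 2 → G) = fun _ => x := by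
    ext i; fin_cases i; simp [Fin.contractNth]
  rw [h1, h2, h3] at h
  simp at h
  linear_combination -h

theorem d_mul_of_cocycles_one {a b : Cochain R G 1} (ha : a ∈ cocycles R G 1)
    (hb : b ∈ cocycles R G 1) :
    d R G 1 (-(a * b)) = cup rfl a b + cup rfl b a := by
  ext z
  obtain ⟨x, y, rfl⟩ : ∃ x y : G, z = ![x, y] := ⟨z 0, z 1, by ext i; fin_cases i <;> rfl⟩
  have h1 : (fun i : Fin 1 => (![x, y] : Fin 2 → G) i.succ) = fun _ => y := by
    ext i; fin_cases i; rfl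
  have h2 : Fin.contractNth (0 : Fin 2) (· * ·) (![x, y] : Fin 2 → G) = fun _ => x * y := by
    ext i; fin_cases i; simp [Fin.contractNth]
  have h3 : Fin.contractNth (1 : Fin 2) (· * ·) (![x, y] : Fin 2 → G) = fun _ => x := by
    ext i; fin_cases i; simp [Fin.contractNth]
  have h4 : (fun i : Fin 1 => (![x, y] : Fin 2 → G) ⟨i, by omega⟩) = fun _ => x := by
    ext i; fin_cases i; rfl
  have h5 : (fun i : Fin 1 => (![x, y] : Fin 2 → G) ⟨1 + i, by omega⟩) = fun _ => y := by
    ext i; fin_cases i; rfl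
  rw [map_neg]
  change - d R G 1 (a * b) ![x, y] = cup rfl a b ![x, y] + cup rfl b a ![x, y]
  rw [d_apply, cup_apply, cup_apply, Fin.sum_univ_two, h1, h2, h3, h4, h5]
  simp only [LocallyConstant.mul_apply, cocycles_one_apply ha, cocycles_one_apply hb]
  simp
  ring

/-- Graded commutativity of the cup product of classes of degree one. -/
theorem H.mul_anticomm (a b : H R G 1) :
    GradedMonoid.GMul.mul a b = -GradedMonoid.GMul.mul b a := by
  obtain ⟨a, rfl⟩ := H.mk_surjective a
  obtain ⟨b, rfl⟩ := H.mk_surjective b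
  rw [H.mk_mul_mk, H.mk_mul_mk, ← map_neg]
  refine H.mk_eq_mk.2 ⟨-(a.1 * b.1), ?_⟩
  rw [d_mul_of_cocycles_one a.2 b.2]
  exact (sub_neg_eq_add _ _).symm

end Cohomology

section Pullback

variable (R : Type*) [CommRing R]
variable {G₁ G₂ : Type*} [Group G₁] [TopologicalSpace G₁] [IsTopologicalGroup G₁]
  [Group G₂] [TopologicalSpace G₂] [IsTopologicalGroup G₂]

/-- The map `f ↦ f ∘ (π × ⋯ × π)` on continuous cochains. -/
def cochainMap (π : G₁ →ₜ* G₂) (n : ℕ) : Cochain R G₂ n →ₗ[R] Cochain R G₁ n :=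
  LocallyConstant.comapₗ R ⟨fun x i => π (x i), by fun_prop⟩

theorem cochainMap_apply (π : G₁ →ₜ* G₂) (n : ℕ) (f : Cochain R G₂ n) (x : Fin n → G₁) :
    cochainMap R π n f x = f (fun i => π (x i)) := rfl

theorem d_cochainMap (π : G₁ →ₜ* G₂) (n : ℕ) (f : Cochain R G₂ n) :
    d R G₁ n (cochainMap R π n f) = cochainMap R π (n + 1) (d R G₂ n f) := by
  ext x
  simp only [d_apply, cochainMap_apply]
  congr! 4 with j
  ext i
  unfold Fin.contractNth
  split_ifs <;> simp

theorem cochainMap_mem_cocycles (π : G₁ →ₜ* G₂) (n : ℕ) (f : Cochain R G₂ n)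
    (hf : f ∈ cocycles R G₂ n) : cochainMap R π n f ∈ cocycles R G₁ n := by
  change d R G₁ n _ = 0
  rw [d_cochainMap, show d R G₂ n f = 0 from hf, map_zero]

theorem cochainMap_mem_coboundaries (π : G₁ →ₜ* G₂) (n : ℕ) (f : Cochain R G₂ n)
    (hf : f ∈ coboundaries R G₂ n) : cochainMap R π n f ∈ coboundaries R G₁ n := by
  cases n with
  | zero => rw [show f = 0 from hf, map_zero]; exact zero_mem _
  | succ n =>
    obtain ⟨c, rfl⟩ := hf
    exact ⟨cochainMap R π n c, d_cochainMap R π n c⟩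

/-- `π_n^* : H^n(G₂) → H^n(G₁)`. -/
def H.map (π : G₁ →ₜ* G₂) (n : ℕ) : H R G₂ n →ₗ[R] H R G₁ n :=
  Submodule.mapQ _ _ ((cochainMap R π n).restrict (cochainMap_mem_cocycles R π n))
    (fun f hf => cochainMap_mem_coboundaries R π n f.1 hf)

theorem H.map_mk (π : G₁ →ₜ* G₂) (n : ℕ) (f : cocycles R G₂ n) :
    H.map R π n (H.mk R G₂ n f) =
      H.mk R G₁ n ⟨cochainMap R π n f.1, cochainMap_mem_cocycles R π n f.1 f.2⟩ := rfl

end Pullback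

section GradedAlgebra

variable (R : Type*) [CommRing R]
variable (A : ℕ → Type*) [∀ i, AddCommGroup (A i)] [∀ i, Module R (A i)]
  [DirectSum.GRing A] [DirectSum.GAlgebra R A]
variable (B : ℕ → Type*) [∀ i, AddCommGroup (B i)] [∀ i, Module R (B i)]
  [DirectSum.GRing B] [DirectSum.GAlgebra R B]

/-- `A_{dec,r}`: the submodule of `A_r` generated by the products of `r` elements of `A_1`. -/
def decPart (r : ℕ) : Submodule R (A r) :=
  Submodule.span R {x | ∃ a : Fin r → A 1,
    DirectSum.of A r x = (List.ofFn fun i => DirectSum.of A 1 (a i)).prod}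

theorem mul_mem_decPart {i j : ℕ} {x : A i} {y : A j} (hx : x ∈ decPart R A i)
    (hy : y ∈ decPart R A j) : GradedMonoid.GMul.mul x y ∈ decPart R A (i + j) := by
  have h := Submodule.apply_mem_map₂ (DirectSum.gMulLHom R A) hx hy
  rw [decPart, decPart, Submodule.map₂_span_span] at h
  refine Submodule.span_le.2 ?_ h
  rintro _ ⟨x, ⟨a, ha⟩, y, ⟨b, hb⟩, rfl⟩
  refine Submodule.subset_span ⟨Fin.append a b, ?_⟩
  change DirectSum.of A (i + j) (GradedMonoid.GMul.mul x y) = _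
  rw [← DirectSum.of_mul_of, ha, hb, ← List.prod_append]
  congr 1
  rw [← List.ofFn_fin_append]
  congr 1
  ext k
  refine Fin.addCases (fun i => ?_) (fun i => ?_) k <;> simp

theorem one_mem_decPart : (GradedMonoid.GOne.one : A 0) ∈ decPart R A 0 :=
  Submodule.subset_span ⟨Fin.elim0, by simp; rfl⟩

theorem mem_decPart_one (a : A 1) : a ∈ decPart R A 1 :=
  Submodule.subset_span ⟨fun _ => a, by simp⟩

theorem of_apply_mem_decPart {i : ℕ} {x : A i} (hx : x ∈ decPart R A i) (r : ℕ) :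
    DirectSum.of A i x r ∈ decPart R A r := by
  rcases eq_or_ne i r with rfl | h
  · rwa [DirectSum.of_eq_same]
  · rw [DirectSum.of_eq_of_ne _ _ _ h.symm]; exact zero_mem _

/-- The decomposable part `A_dec = ⨁ A_{dec,r}`. -/
def dec : Subalgebra R (DirectSum ℕ A) where
  carrier := {x | ∀ r, x r ∈ decPart R A r}
  add_mem' hx hy r := add_mem (hx r) (hy r)
  mul_mem' {x y} hx hy r := by
    classical
    rw [DirectSum.mul_eq_sum_support_ghas_mul, DFinsupp.finsetSum_apply]
    exact sum_mem fun ij _ => of_apply_mem_decPart R A (mul_mem_decPart R A (hx _) (hy _)) r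
  algebraMap_mem' c r := by
    rw [Algebra.algebraMap_eq_smul_one]
    exact Submodule.smul_mem _ _ (of_apply_mem_decPart R A (one_mem_decPart R A) r)

/-- The inclusion `A_1 → A_dec`. -/
def decOfDegOne : A 1 →ₗ[R] dec R A where
  toFun a := ⟨DirectSum.of A 1 a, of_apply_mem_decPart R A (mem_decPart_one R A a)⟩
  map_add' a b := Subtype.ext (map_add _ a b)
  map_smul' c a := Subtype.ext ((DirectSum.lof R ℕ A 1).map_smul c a)

/-- The relations `a_1 ⊗ ⋯ ⊗ a_r = 0` for `a_1, …, a_r ∈ A_1` such that `a_i a_j = 0` in `A_2`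
for some `i ≠ j`. -/
inductive HullRel : TensorAlgebra R (A 1) → TensorAlgebra R (A 1) → Prop
  | mk (r : ℕ) (a : Fin r → A 1) (i j : Fin r) (hij : i ≠ j)
      (h : GradedMonoid.GMul.mul (a i) (a j) = 0) : HullRel (TensorAlgebra.tprod R (A 1) r a) 0

/-- The quadratic hull `Â = ⨁ A_1^{⊗ r} / T_r`: the quotient of the tensor algebra
`⨁ A_1^{⊗ r}` of `A_1` by the two-sided ideal generated by the tensors `a_1 ⊗ ⋯ ⊗ a_r` such that
`a_i a_j = 0` for some `i ≠ j`. As these tensors stay of this form when multiplied by pure tensors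
on either side, that ideal is `⨁ T_r`, with `T_r` the submodule they span in degree `r`. -/
abbrev Hull : Type _ := RingQuot (HullRel R A)

/-- Elements of degree one anticommute; this is the part of graded commutativity that concerns
degree one, and all that is used of it. -/
class DegOneAnticomm : Prop where
  anticomm : ∀ a b : A 1, GradedMonoid.GMul.mul a b = -GradedMonoid.GMul.mul b a

section omega

variable {A}

theorem of_mul_prod_eq [DegOneAnticomm A] (x : A 1) (l : List (A 1)) :
    DirectSum.of A 1 x * (l.map (DirectSum.of A 1)).prod =
      (-1) ^ l.length * ((l.map (DirectSum.of A 1)).prod * DirectSum.of A 1 x) := by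
  induction l with
  | nil => simp
  | cons y l ih =>
    have h : DirectSum.of A 1 x * DirectSum.of A 1 y =
        -(DirectSum.of A 1 y * DirectSum.of A 1 x) := by
      rw [DirectSum.of_mul_of, DirectSum.of_mul_of, DegOneAnticomm.anticomm x y, map_neg]
    have hc : Commute (DirectSum.of A 1 y) ((-1) ^ l.length) :=
      ((Commute.one_right _).neg_right).pow_right _
    rw [List.map_cons, List.prod_cons, ← mul_assoc, h, neg_mul, mul_assoc, ih, ← mul_assoc,
      hc.eq, List.length_cons, pow_succ]
    simp only [mul_assoc, mul_neg, neg_mul, mul_one]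

theorem prod_eq_zero_aux [DegOneAnticomm A] (x y : A 1) (l₁ l₂ l₃ : List (A 1))
    (h : GradedMonoid.GMul.mul x y = 0) :
    ((l₁ ++ x :: (l₂ ++ y :: l₃)).map (DirectSum.of A 1)).prod = 0 := by
  have hxy : DirectSum.of A 1 x * DirectSum.of A 1 y = 0 := by
    rw [DirectSum.of_mul_of, h, map_zero]
  simp only [List.map_append, List.map_cons, List.prod_append, List.prod_cons]
  rw [← mul_assoc (DirectSum.of A 1 x), of_mul_prod_eq]
  simp only [mul_assoc]
  rw [← mul_assoc (DirectSum.of A 1 x) (DirectSum.of A 1 y), hxy]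
  simp

theorem list_split {α : Type*} {r : ℕ} (a : Fin r → α) {i j : Fin r} (hij : i < j) :
    ∃ l₁ l₂ l₃, List.ofFn a = l₁ ++ a i :: (l₂ ++ a j :: l₃) := by
  have hi : (i : ℕ) < (List.ofFn a).length := by simp
  have hlen : (List.ofFn a).length = r := by simp
  have h1 := List.take_append_drop (i : ℕ) (List.ofFn a)
  rw [List.drop_eq_getElem_cons hi] at h1
  set l := (List.ofFn a).drop (i + 1) with hl
  have hk : (j : ℕ) - i - 1 < l.length := by
    rw [hl, List.length_drop, hlen]; have := j.2; have : (i : ℕ) < j := hij; omega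
  have h2 := List.take_append_drop ((j : ℕ) - i - 1) l
  rw [List.drop_eq_getElem_cons hk] at h2
  have h3 : l[(j : ℕ) - i - 1] = a j := by
    simp only [hl, List.getElem_drop, List.getElem_ofFn]
    congr 1; ext; have : (i : ℕ) < j := hij; simp; omega
  have h4 : (List.ofFn a)[(i : ℕ)] = a i := by simp
  rw [h3] at h2
  rw [h4, ← h2] at h1
  exact ⟨_, _, _, h1.symm⟩

theorem prod_eq_zero [DegOneAnticomm A] {r : ℕ} (a : Fin r → A 1) {i j : Fin r} (hij : i ≠ j)
    (h : GradedMonoid.GMul.mul (a i) (a j) = 0) :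
    (List.ofFn fun i => DirectSum.of A 1 (a i)).prod = 0 := by
  have e : (List.ofFn fun i => DirectSum.of A 1 (a i)) = (List.ofFn a).map (DirectSum.of A 1) := by
    rw [List.map_ofFn]; rfl
  rw [e]
  rcases lt_or_gt_of_ne hij with hlt | hlt
  · obtain ⟨l₁, l₂, l₃, hl⟩ := list_split a hlt
    rw [hl]
    exact prod_eq_zero_aux _ _ _ _ _ h
  · obtain ⟨l₁, l₂, l₃, hl⟩ := list_split a hlt
    rw [hl]
    refine prod_eq_zero_aux _ _ _ _ _ ?_
    rw [DegOneAnticomm.anticomm, h, neg_zero]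

end omega

/-- The canonical epimorphism `ω_A : Â → A_dec`, the identity in degree one. -/
def omega [DegOneAnticomm A] : Hull R A →ₐ[R] dec R A :=
  RingQuot.liftAlgHom R ⟨TensorAlgebra.lift R (decOfDegOne R A), by
    rintro _ _ ⟨r, a, i, j, hij, h⟩
    apply Subtype.ext
    rw [map_zero, TensorAlgebra.tprod_apply, map_list_prod, List.map_ofFn,
      ← Subalgebra.coe_val, map_list_prod, List.map_ofFn, map_zero, ← prod_eq_zero a hij h]
    congr 2
    ext k : 1
    simp [decOfDegOne]⟩

/-- `A` is quadratic if `ω_A` is an isomorphism. -/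
def IsQuadratic [DegOneAnticomm A] : Prop := Function.Bijective (omega R A)

/-- `A_r` is decomposable if `A_r = A_{dec,r}`. -/
def IsDecomposableIn (r : ℕ) : Prop := decPart R A r = ⊤

/-- Morphisms of graded `R`-algebras. -/
structure GrHom where
  toFun : ∀ r, A r →ₗ[R] B r
  map_one : toFun 0 GradedMonoid.GOne.one = GradedMonoid.GOne.one
  map_mul : ∀ {i j : ℕ} (a : A i) (b : A j),
    toFun (i + j) (GradedMonoid.GMul.mul a b) = GradedMonoid.GMul.mul (toFun i a) (toFun j b)

variable {R A B}

namespace GrHom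

/-- The algebra morphism `⨁ A_r → ⨁ B_r` with components `φ_r`. -/
def total (φ : GrHom R A B) : DirectSum ℕ A →ₐ[R] DirectSum ℕ B :=
  DirectSum.toAlgebra R A (fun r => DirectSum.lof R ℕ B r ∘ₗ φ.toFun r)
    (congrArg (DirectSum.of B 0) φ.map_one)
    (fun {i j} a b => by
      simp only [LinearMap.comp_apply, φ.map_mul]
      exact (DirectSum.of_mul_of _ _).symm)

theorem total_of (φ : GrHom R A B) (r : ℕ) (a : A r) :
    φ.total (DirectSum.of A r a) = DirectSum.of B r (φ.toFun r a) := by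
  exact DirectSum.toAddMonoid_of
    (fun r => (DirectSum.lof R ℕ B r ∘ₗ φ.toFun r).toAddMonoidHom) r a

theorem total_apply (φ : GrHom R A B) (x : DirectSum ℕ A) (r : ℕ) :
    φ.total x r = φ.toFun r (x r) := by
  induction x using DirectSum.induction_on with
  | zero => simp
  | of i a =>
    rw [total_of]
    rcases eq_or_ne i r with rfl | h
    · rw [DirectSum.of_eq_same, DirectSum.of_eq_same]
    · rw [DirectSum.of_eq_of_ne _ _ _ h.symm, DirectSum.of_eq_of_ne _ _ _ h.symm, _root_.map_zero]
  | add x y hx hy =>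
    rw [_root_.map_add, DirectSum.add_apply, hx, hy, DirectSum.add_apply, _root_.map_add]

theorem toFun_mem_decPart (φ : GrHom R A B) {r : ℕ} {a : A r} (ha : a ∈ decPart R A r) :
    φ.toFun r a ∈ decPart R B r := by
  have h : decPart R A r ≤ (decPart R B r).comap (φ.toFun r) := by
    refine Submodule.span_le.2 ?_
    rintro x ⟨a, hx⟩
    refine Submodule.subset_span ⟨fun i => φ.toFun 1 (a i), ?_⟩
    rw [← total_of, hx, map_list_prod, List.map_ofFn]
    congr 2
    ext k : 1
    exact total_of φ 1 (a k)
  exact h ha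

/-- `φ_dec : A_dec → B_dec`. -/
def dec (φ : GrHom R A B) : QuadCoh.dec R A →ₐ[R] QuadCoh.dec R B :=
  (φ.total.comp (QuadCoh.dec R A).val).codRestrict (QuadCoh.dec R B) fun x r => by
    change φ.total x.1 r ∈ _
    rw [total_apply]
    exact φ.toFun_mem_decPart (x.2 r)

/-- `φ̂ : Â → B̂`. -/
def hull (φ : GrHom R A B) : Hull R A →ₐ[R] Hull R B :=
  RingQuot.liftAlgHom R ⟨(RingQuot.mkAlgHom R (HullRel R B)).comp
    (TensorAlgebra.lift R (TensorAlgebra.ι R ∘ₗ φ.toFun 1)), by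
    rintro _ _ ⟨r, a, i, j, hij, h⟩
    have h' : GradedMonoid.GMul.mul (φ.toFun 1 (a i)) (φ.toFun 1 (a j)) = 0 := by
      rw [← φ.map_mul, h, _root_.map_zero]
    have e : TensorAlgebra.lift R (TensorAlgebra.ι R ∘ₗ φ.toFun 1)
        (TensorAlgebra.tprod R (A 1) r a) =
        TensorAlgebra.tprod R (B 1) r (fun k => φ.toFun 1 (a k)) := by
      rw [TensorAlgebra.tprod_apply, TensorAlgebra.tprod_apply, map_list_prod, List.map_ofFn]
      congr 2
      ext k : 1
      simp
    rw [AlgHom.comp_apply, e, _root_.map_zero]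
    exact (RingQuot.mkAlgHom_rel R (HullRel.mk r _ i j hij h')).trans (_root_.map_zero _)⟩

end GrHom

end GradedAlgebra

section Final

variable (R : Type*) [CommRing R]

instance (G : Type*) [Group G] [TopologicalSpace G] [IsTopologicalGroup G] :
    DegOneAnticomm (H R G) := ⟨H.mul_anticomm⟩

/-- `π^*` as a morphism of graded algebras. -/
def pullback {G₁ G₂ : Type*} [Group G₁] [TopologicalSpace G₁] [IsTopologicalGroup G₁]
    [Group G₂] [TopologicalSpace G₂] [IsTopologicalGroup G₂] (π : G₁ →ₜ* G₂) :
    GrHom R (H R G₂) (H R G₁) where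
  toFun := H.map R π
  map_one := rfl
  map_mul {i j} a b := by
    obtain ⟨a, rfl⟩ := H.mk_surjective a
    obtain ⟨b, rfl⟩ := H.mk_surjective b
    rfl

end Final

section Series

variable (q : ℕ) (G : Type*) [Group G] [TopologicalSpace G] [IsTopologicalGroup G]

/-- The descending `q`-central sequence `G^{(1)} = G`, `G^{(i+1)} = (G^{(i)})^q [G^{(i)}, G]`:
`G^{(i+1)}` is topologically generated by all `h^q` and `[h, g] = h⁻¹ g⁻¹ h g`, with
`h ∈ G^{(i)}` and `g ∈ G`. Indexing starts at `i = 1` (the value at `0` is not used). -/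
def descSeries : ℕ → Subgroup G
  | 0 => ⊤
  | 1 => ⊤
  | i + 2 => (Subgroup.closure
      ({x | ∃ h ∈ descSeries (i + 1), x = h ^ q} ∪
        {x | ∃ h ∈ descSeries (i + 1), ∃ g : G, x = h⁻¹ * g⁻¹ * h * g})).topologicalClosure

instance descSeries_normal : ∀ i, (descSeries q G i).Normal
  | 0 => inferInstanceAs (⊤ : Subgroup G).Normal
  | 1 => inferInstanceAs (⊤ : Subgroup G).Normal
  | i + 2 => by
    have ih := descSeries_normal (i + 1)
    rw [descSeries]
    refine @Subgroup.is_normal_topologicalClosure _ _ _ _ _ ⟨fun x hx k => ?_⟩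
    induction hx using Subgroup.closure_induction with
    | mem x hx =>
      apply Subgroup.subset_closure
      rcases hx with ⟨h, hh, rfl⟩ | ⟨h, hh, g, rfl⟩
      · exact Or.inl ⟨k * h * k⁻¹, ih.conj_mem h hh k, conj_pow.symm⟩
      · exact Or.inr ⟨k * h * k⁻¹, ih.conj_mem h hh k, k * g * k⁻¹, by group⟩
    | one => simp
    | mul x y _ _ hx hy =>
      have : k * (x * y) * k⁻¹ = (k * x * k⁻¹) * (k * y * k⁻¹) := by group
      rw [this]; exact mul_mem hx hy
    | inv x _ hx =>
      have : k * x⁻¹ * k⁻¹ = (k * x * k⁻¹)⁻¹ := by group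
      rw [this]; exact inv_mem hx

/-- `G^{[i]} = G / G^{(i)}`. -/
abbrev descQuot (i : ℕ) : Type _ := G ⧸ descSeries q G i

variable {G} {G' : Type*} [Group G'] [TopologicalSpace G'] [IsTopologicalGroup G']

theorem descSeries_le_comap (π : G →ₜ* G') :
    ∀ i, descSeries q G i ≤ (descSeries q G' i).comap (π : G →* G')
  | 0 => fun _ _ => trivial
  | 1 => fun _ _ => trivial
  | i + 2 => by
    have ih := descSeries_le_comap π (i + 1)
    rw [descSeries, descSeries]
    refine Subgroup.topologicalClosure_minimal _ ?_ ?_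
    · refine (Subgroup.closure_le _).2 ?_
      rintro _ (⟨h, hh, rfl⟩ | ⟨h, hh, g, rfl⟩)
      · exact Subgroup.le_topologicalClosure _
          (Subgroup.subset_closure (Or.inl ⟨π h, ih hh, by simp⟩))
      · exact Subgroup.le_topologicalClosure _
          (Subgroup.subset_closure (Or.inr ⟨π h, ih hh, π g, by simp⟩))
    · exact (Subgroup.isClosed_topologicalClosure _).preimage π.continuous_toFun

/-- `π^{[i]} : G^{[i]} → G'^{[i]}`. -/
def descQuotMap (π : G →ₜ* G') (i : ℕ) : descQuot q G i →ₜ* descQuot q G' i where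
  toMonoidHom := QuotientGroup.map _ _ (π : G →* G') (descSeries_le_comap q π i)
  continuous_toFun := by
    refine continuous_quot_lift _ ?_
    exact continuous_quot_mk.comp π.continuous_toFun

end Series

end QuadCoh
end

set_option linter.unusedSectionVars false

noncomputable section

/-! The cycle (a) ⇒ (c) ⇒ (d) ⇒ (a) is formal algebra. The quadratic hull depends only on the
degree-one part and on which pairs of its elements have product zero. A morphism bijective in degree
1 and injective in degree 2 preserves and reflects these data, so it is an isomorphism on hulls
(`hull_bijective`). Naturality of `omega`, together with quadraticity of the target, turns this into
an isomorphism of decomposable parts (`dec_bijective`). That in turn sees all of degree 1, and every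
other degree that is decomposable.

The equivalence of (a) and (b) is an argument in the style of the five-term exact sequence, written
with explicit cochains. Here `H^1` is the group of continuous homomorphisms to `ℤ/q`, and
transgression is replaced by functions `u : G → ℤ/q` satisfying `u(ng) = u(n) + u(g)` and `u(gn) =
u(g) + u(n)` for `n ∈ G^{(2)}`. Such functions vanish on `G^{(3)}` (`eq_zero_of_mem_descSeries`),
and they separate the points of `G^{(2)}` modulo `G^{(3)}` (`exists_cochain_ne_zero`).

(b) ⇒ (a): homomorphisms to `ℤ/q` factor through `G^{[3]}`, which settles degree 1. A decomposable
class in degree 2 has a representative `c` pulled back from `G₂^{[2]}` that vanishes when an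
argument lies in `G₂^{(2)}`. If `π^*c = du`, then `u` is equivariant as above, so it descends to
`G₁^{[3]} ≅ G₂^{[3]}` and bounds `c` on `G₂`.

(a) ⇒ (b): duality makes `π^{[2]}` an isomorphism, and surjectivity of `π^{[3]}` follows by a
Frattini-type argument. For injectivity, if `x ∉ G₁^{(3)}` but `π(x) ∈ G₂^{(3)}`, an equivariant `u`
with `u(x) ≠ 0` exists. Its coboundary descends to a cocycle on `G₂` whose class dies in `H^2(G₁)`,
hence already in `H^2(G₂)`. Correcting a bounding cochain by a character yields an equivariant `t`
on `G₂` with `t ∘ π = u`, and `t(π x) = 0` is a contradiction (`mem_descSeries_three_of_map`). -/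

namespace QuadCoh

/-! ### Quadratic hulls and decomposable parts of graded algebras. -/

section Algebra

variable {R : Type*} [CommRing R]
variable {A : ℕ → Type*} [∀ i, AddCommGroup (A i)] [∀ i, Module R (A i)]
  [DirectSum.GRing A] [DirectSum.GAlgebra R A]
variable {B : ℕ → Type*} [∀ i, AddCommGroup (B i)] [∀ i, Module R (B i)]
  [DirectSum.GRing B] [DirectSum.GAlgebra R B]

variable (R A) in
/-- The map `A_1 → Â`. -/
def hullι : A 1 →ₗ[R] Hull R A :=
  (RingQuot.mkAlgHom R (HullRel R A)).toLinearMap ∘ₗ TensorAlgebra.ι R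

theorem hull_algHom_ext {S : Type*} [Semiring S] [Algebra R S] {f g : Hull R A →ₐ[R] S}
    (h : ∀ a, f (hullι R A a) = g (hullι R A a)) : f = g := by
  refine RingQuot.ringQuot_ext' R f g (TensorAlgebra.hom_ext (LinearMap.ext fun a => ?_))
  exact h a

/-- The algebra morphism `Â → S` given by a linear map `A_1 → S` respecting the relations. -/
theorem exists_hull_lift {S : Type*} [Ring S] [Algebra R S] (f : A 1 →ₗ[R] S)
    (hf : ∀ (r : ℕ) (a : Fin r → A 1) (i j : Fin r), i ≠ j →
      GradedMonoid.GMul.mul (a i) (a j) = 0 → (List.ofFn fun k => f (a k)).prod = 0) :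
    ∃ F : Hull R A →ₐ[R] S, ∀ a, F (hullι R A a) = f a := by
  refine ⟨RingQuot.liftAlgHom R ⟨TensorAlgebra.lift R f, ?_⟩, fun a => ?_⟩
  · rintro _ _ ⟨r, a, i, j, hij, h⟩
    rw [map_zero, TensorAlgebra.tprod_apply, map_list_prod, List.map_ofFn, ← hf r a i j hij h]
    congr 2
    ext k : 1
    simp
  · exact (RingQuot.liftAlgHom_mkAlgHom_apply ..).trans (TensorAlgebra.lift_ι_apply ..)

theorem hullι_prod_eq_zero {r : ℕ} (a : Fin r → A 1) {i j : Fin r} (hij : i ≠ j)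
    (h : GradedMonoid.GMul.mul (a i) (a j) = 0) :
    (List.ofFn fun k => hullι R A (a k)).prod = 0 := by
  have := RingQuot.mkAlgHom_rel R (HullRel.mk (R := R) r a i j hij h)
  rw [map_zero, TensorAlgebra.tprod_apply, map_list_prod, List.map_ofFn] at this
  exact this

theorem omega_hullι [DegOneAnticomm A] (a : A 1) :
    omega R A (hullι R A a) = decOfDegOne R A a :=
  (RingQuot.liftAlgHom_mkAlgHom_apply ..).trans (TensorAlgebra.lift_ι_apply ..)

/-- The elements of `A_r` hit by `omega` form a submodule, so it suffices to hit products of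
degree-one elements. -/
theorem omega_surjective [DegOneAnticomm A] : Function.Surjective (omega R A) := by
  suffices h : ∀ r, ∀ x ∈ decPart R A r, ∃ y, (omega R A y : DirectSum ℕ A) =
      DirectSum.of A r x by
    classical
    rintro ⟨x, hx⟩
    choose y hy using fun r => h r (x r) (hx r)
    refine ⟨∑ r ∈ DFinsupp.support x, y r, Subtype.ext ?_⟩
    rw [map_sum, AddSubmonoidClass.coe_finsetSum]
    simp only [hy]
    exact DirectSum.sum_support_of x
  intro r x hx
  let W : Submodule R (DirectSum ℕ A) :=
    LinearMap.range ((dec R A).val.toLinearMap ∘ₗ (omega R A).toLinearMap)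
  suffices h : decPart R A r ≤ W.comap (DirectSum.lof R ℕ A r) from h hx
  refine Submodule.span_le.2 ?_
  rintro x ⟨a, hx⟩
  refine ⟨(List.ofFn fun k => hullι R A (a k)).prod, ?_⟩
  change ((dec R A).val.comp (omega R A)) _ = DirectSum.of A r x
  rw [hx, map_list_prod, List.map_ofFn]
  congr 2
  ext k : 1
  exact congrArg Subtype.val (omega_hullι (R := R) (a k))

namespace GrHom

variable (φ : GrHom R A B)

theorem hull_hullι (a : A 1) : φ.hull (hullι R A a) = hullι R B (φ.toFun 1 a) := by
  refine (RingQuot.liftAlgHom_mkAlgHom_apply ..).trans ?_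
  rw [AlgHom.comp_apply, TensorAlgebra.lift_ι_apply]
  rfl

theorem dec_decOfDegOne (a : A 1) :
    φ.dec (decOfDegOne R A a) = decOfDegOne R B (φ.toFun 1 a) :=
  Subtype.ext (φ.total_of 1 a)

theorem omega_hull [DegOneAnticomm A] [DegOneAnticomm B] (x : Hull R A) :
    omega R B (φ.hull x) = φ.dec (omega R A x) := by
  suffices h : (omega R B).comp φ.hull = φ.dec.comp (omega R A) from DFunLike.congr_fun h x
  refine hull_algHom_ext fun a => ?_
  simp only [AlgHom.comp_apply, hull_hullι, omega_hullι, dec_decOfDegOne]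

/-- The inverse is induced by the inverse in degree 1; injectivity in degree 2 is what makes that
inverse respect the hull relations. -/
theorem hull_bijective (h1 : Function.Bijective (φ.toFun 1))
    (h2 : Function.Injective (φ.toFun 2)) : Function.Bijective φ.hull := by
  let e := LinearEquiv.ofBijective (φ.toFun 1) h1
  have he : ∀ b, φ.toFun 1 (e.symm b) = b := e.apply_symm_apply
  obtain ⟨ψ, hψ⟩ := exists_hull_lift (A := B) (hullι R A ∘ₗ e.symm.toLinearMap)
    fun r a i j hij h => by
      refine hullι_prod_eq_zero (fun k => e.symm (a k)) hij (h2 ?_)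
      have := φ.map_mul (e.symm (a i)) (e.symm (a j))
      rw [he, he, h] at this
      exact this.trans (_root_.map_zero _).symm
  have l : ψ.comp φ.hull = AlgHom.id R _ := hull_algHom_ext fun a => by
    rw [AlgHom.comp_apply, hull_hullι, hψ]
    exact congrArg (hullι R A) (e.symm_apply_apply a)
  have r : φ.hull.comp ψ = AlgHom.id R _ := hull_algHom_ext fun a => by
    rw [AlgHom.comp_apply, hψ]
    exact (hull_hullι φ _).trans (congrArg (hullι R B) (he a))
  exact Function.bijective_iff_has_inverse.2
    ⟨ψ, fun x => DFunLike.congr_fun l x, fun x => DFunLike.congr_fun r x⟩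

/-- In the naturality square of `omega` the composite is bijective; since `omega R A` is onto,
injectivity passes to `φ.dec`, with no quadraticity needed for `A`. -/
theorem dec_bijective [DegOneAnticomm A] [DegOneAnticomm B] (hB : IsQuadratic R B)
    (h : Function.Bijective φ.hull) : Function.Bijective φ.dec := by
  have hc : Function.Bijective (φ.dec ∘ omega R A) := by
    rw [show φ.dec ∘ omega R A = omega R B ∘ φ.hull from funext fun x => (φ.omega_hull x).symm]
    exact hB.comp h
  refine ⟨fun x y hxy => ?_, hc.2.of_comp⟩
  obtain ⟨x, rfl⟩ := omega_surjective x
  obtain ⟨y, rfl⟩ := omega_surjective y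
  exact congrArg _ (hc.1 hxy)

theorem injective_of_dec_injective (h : Function.Injective φ.dec) {r : ℕ}
    (hr : IsDecomposableIn R A r) : Function.Injective (φ.toFun r) := by
  intro a b hab
  have hm : ∀ a : A r, DirectSum.of A r a ∈ QuadCoh.dec R A := fun a =>
    of_apply_mem_decPart R A (hr ▸ Submodule.mem_top)
  have : φ.dec ⟨_, hm a⟩ = φ.dec ⟨_, hm b⟩ := Subtype.ext <| by
    change φ.total (DirectSum.of A r a) = φ.total (DirectSum.of A r b)
    rw [total_of, total_of, hab]
  exact DirectSum.of_injective r (congrArg Subtype.val (h this))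

theorem bijective_of_dec_bijective (h : Function.Bijective φ.dec) :
    Function.Bijective (φ.toFun 1) := by
  refine ⟨φ.injective_of_dec_injective h.1 (eq_top_iff.2 fun a _ => mem_decPart_one R A a),
    fun b => ?_⟩
  obtain ⟨x, hx⟩ := h.2 (decOfDegOne R B b)
  refine ⟨x.1 1, ?_⟩
  rw [← total_apply]
  have := congrArg (fun y : QuadCoh.dec R B => y.1 1) hx
  exact this.trans (DirectSum.of_eq_same 1 b)

end GrHom

end Algebra

/-! ### Duality for finite abelian groups, and characters of profinite groups. -/

section Characters

/-- This lets the duality theorem for finite abelian groups be applied with `ℤ/q`, written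
multiplicatively, in the role of the roots of unity. -/
theorem hasEnoughRootsOfUnity_multiplicative_zmod (q : ℕ) [NeZero q] :
    HasEnoughRootsOfUnity (Multiplicative (ZMod q)) q where
  prim := by
    refine ⟨Multiplicative.ofAdd 1, ?_⟩
    have h : orderOf (Multiplicative.ofAdd (1 : ZMod q)) = q := by
      rw [orderOf_ofAdd_eq_addOrderOf, ZMod.addOrderOf_one]
    simpa only [h] using IsPrimitiveRoot.orderOf (Multiplicative.ofAdd (1 : ZMod q))
  cyc := by
    have : IsCyclic (Multiplicative (ZMod q))ˣ :=
      isCyclic_of_surjective (toUnits : Multiplicative (ZMod q) ≃* _) toUnits.surjective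
    infer_instance

theorem exists_zmod_character_ne_zero {q : ℕ} [NeZero q] {A : Type*} [CommGroup A] [Finite A]
    (h : ∀ a : A, a ^ q = 1) {a : A} (ha : a ≠ 1) :
    ∃ f : A → ZMod q, (∀ x y, f (x * y) = f x + f y) ∧ f a ≠ 0 := by
  have := hasEnoughRootsOfUnity_multiplicative_zmod q
  have : HasEnoughRootsOfUnity (Multiplicative (ZMod q)) (Monoid.exponent A) :=
    HasEnoughRootsOfUnity.of_dvd _ (Monoid.exponent_dvd_of_forall_pow_eq_one h)
  obtain ⟨χ, hχ⟩ := CommGroup.exists_apply_ne_one_of_hasEnoughRootsOfUnity A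
    (Multiplicative (ZMod q)) ha
  refine ⟨fun x => (χ x : Multiplicative (ZMod q)).toAdd, fun x y => by simp, fun h0 => hχ ?_⟩
  exact Units.ext (Multiplicative.toAdd.injective h0)

variable {G : Type*} [Group G] [TopologicalSpace G] [IsTopologicalGroup G]
  [CompactSpace G] [TotallyDisconnectedSpace G]

/-- Characters of exponent `q` separate points from closed subgroups with abelian quotient of
exponent dividing `q`. -/
theorem exists_character_of_notMem [T2Space G] {q : ℕ} [NeZero q] {N : Subgroup G}
    (hN : IsClosed (N : Set G))
    (hpow : ∀ h : G, h ^ q ∈ N) (hcomm : ∀ h g : G, h⁻¹ * g⁻¹ * h * g ∈ N) {x : G} (hx : x ∉ N) :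
    ∃ f : LocallyConstant G (ZMod q), (∀ a b, f (a * b) = f a + f b) ∧ (∀ n ∈ N, f n = 0) ∧
      f x ≠ 0 := by
  -- An open normal `U` inside this neighbourhood of 1 satisfies `xU ∩ N = ∅`, so `x` survives in
  -- the finite abelian quotient by `NU`.
  have hW : IsOpen {u : G | x * u ∉ N} :=
    hN.isOpen_compl.preimage (continuous_const.mul continuous_id)
  obtain ⟨U, hU⟩ := ProfiniteGrp.exist_openNormalSubgroup_sub_open_nhds_of_one hW
    (by simpa using hx)
  set M : Subgroup G := N ⊔ U.toSubgroup with hM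
  have hMo : IsOpen (M : Set G) := Subgroup.isOpen_mono le_sup_right U.isOpen'
  have hxM : x ∉ M := by
    intro h
    obtain ⟨n, hn, u, hu, rfl⟩ := Subgroup.mem_sup_of_normal_right.1 h
    exact hU (inv_mem hu : u⁻¹ ∈ U.toSubgroup) (by simpa using hn)
  have hMc : ∀ h g : G, h⁻¹ * g⁻¹ * h * g ∈ M := fun h g => (le_sup_left : N ≤ M) (hcomm h g)
  have hMn : M.Normal := ⟨fun n hn g => by
    have h := mul_mem hn (hMc n g⁻¹)
    have e : n * (n⁻¹ * g⁻¹⁻¹ * n * g⁻¹) = g * n * g⁻¹ := by group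
    rwa [e] at h⟩
  have : Finite (G ⧸ M) := M.quotient_finite_of_isOpen hMo
  let : CommGroup (G ⧸ M) :=
    { (inferInstance : Group (G ⧸ M)) with
      mul_comm := by
        intro a b
        obtain ⟨a, rfl⟩ := QuotientGroup.mk_surjective a
        obtain ⟨b, rfl⟩ := QuotientGroup.mk_surjective b
        refine QuotientGroup.eq.2 ?_
        have e : (a * b)⁻¹ * (b * a) = b⁻¹ * a⁻¹ * b * a := by group
        exact e ▸ hMc b a }
  obtain ⟨f, hf, hfx⟩ := exists_zmod_character_ne_zero (q := q) (A := G ⧸ M)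
    (fun a => by
      obtain ⟨a, rfl⟩ := QuotientGroup.mk_surjective a
      exact (QuotientGroup.eq_one_iff (N := M) _).2 ((le_sup_left : N ≤ M) (hpow a)))
    (a := (x : G ⧸ M)) (fun h => hxM ((QuotientGroup.eq_one_iff _).1 h))
  have hlc : IsLocallyConstant fun g : G => f (g : G ⧸ M) := by
    refine (IsLocallyConstant.iff_exists_open _).2 fun g => ⟨(g * ·) '' (M : Set G),
      isOpenMap_mul_left g _ hMo, ⟨1, one_mem M, mul_one g⟩, ?_⟩
    rintro _ ⟨m, hm, rfl⟩
    exact congrArg f (QuotientGroup.mk_mul_of_mem g hm)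
  refine ⟨⟨_, hlc⟩, fun a b => hf a b, fun n hn => ?_, hfx⟩
  have h1 : f 1 = 0 := by simpa using hf 1 1
  exact (congrArg f ((QuotientGroup.eq_one_iff n).2 ((le_sup_left : N ≤ M) hn))).trans h1

/-- An invariant character of a closed normal subgroup `N` extends to a continuous map on `G`
that is equivariant for translation by `N`. -/
theorem exists_extension_of_invariant {R : Type*} [AddCommGroup R] {N : Subgroup G} [hNn : N.Normal]
    (f : LocallyConstant N R) (hf : ∀ a b, f (a * b) = f a + f b)
    (hinv : ∀ (n : N) (g : G), f ⟨g * n * g⁻¹, hNn.conj_mem n n.2 g⟩ = f n) [T2Space G] :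
    ∃ u : LocallyConstant G R, u 1 = 0 ∧ (∀ (n : N) (g : G), u (n * g) = f n + u g) ∧
      ∀ (n : N) (g : G), u (g * n) = u g + f n := by
  classical
  -- `W` is open in `G` and meets `N` exactly in the kernel of `f`. An open normal `V ⊆ W` therefore
  -- has `f = 0` on `N ∩ V`.
  obtain ⟨W, hW, hWf⟩ := isOpen_induced_iff.1 (f.isLocallyConstant {0})
  have h1 : f 1 = 0 := by simpa using hf 1 1
  have hinvn : ∀ n : N, f n⁻¹ = - f n := fun n => by
    rw [eq_neg_iff_add_eq_zero, ← hf, inv_mul_cancel, h1]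
  have hmemW : ∀ n : N, (n : G) ∈ W ↔ f n = 0 := fun n => by
    have : n ∈ Subtype.val ⁻¹' W ↔ n ∈ f.toFun ⁻¹' {0} := by rw [hWf]
    exact this
  obtain ⟨V, hV⟩ := ProfiniteGrp.exist_openNormalSubgroup_sub_open_nhds_of_one hW
    ((hmemW 1).2 h1)
  have hVn : V.toSubgroup.Normal := V.isNormal'
  have hVf : ∀ n : N, (n : G) ∈ V.toSubgroup → f n = 0 := fun n hn => (hmemW n).1 (hV hn)
  -- The extension of `f` to `NV` by `nv ↦ f(n)`, well defined because `f` vanishes on `N ∩ V`; the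
  -- value 0 off `NV` never matters.
  let F : G → R := fun g => if h : ∃ n : N, (n : G)⁻¹ * g ∈ V.toSubgroup then f h.choose else 0
  have hF : ∀ (n : N), ∀ v ∈ V.toSubgroup, F (n * v) = f n := by
    intro n v hv
    have h : ∃ n' : N, (n' : G)⁻¹ * (n * v) ∈ V.toSubgroup := ⟨n, by simpa using hv⟩
    have hs := h.choose_spec
    simp only [F, dif_pos h]
    have : ((h.choose⁻¹ * n : N) : G) ∈ V.toSubgroup := by
      have := mul_mem hs (inv_mem hv)
      simpa [mul_assoc] using this
    have := hVf _ this
    rw [hf, hinvn] at this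
    exact (neg_add_eq_zero.1 this)
  set M : Subgroup G := N ⊔ V.toSubgroup with hM
  -- A choice of representatives of the cosets `gM`, `M = NV`. Since `s(g)⁻¹g ∈ M`, the function
  -- `u(g) = F(s(g)⁻¹g)` inherits right equivariance from `F`.
  let s : G → G := fun g => (g : G ⧸ M).out
  have hs : ∀ g, ∃ n : N, ∃ v ∈ V.toSubgroup, (s g)⁻¹ * g = n * v := by
    intro g
    have : (s g)⁻¹ * g ∈ M := QuotientGroup.eq.1 (QuotientGroup.out_eq' (g : G ⧸ M))
    obtain ⟨n, hn, v, hv, e⟩ := Subgroup.mem_sup_of_normal_right.1 this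
    exact ⟨⟨n, hn⟩, v, hv, e.symm⟩
  have hsM : ∀ g, ∀ m ∈ M, s (g * m) = s g := fun g m hm =>
    congrArg Quotient.out (QuotientGroup.mk_mul_of_mem g hm)
  let u : G → R := fun g => F ((s g)⁻¹ * g)
  have hur : ∀ (n : N) (g : G), u (g * n) = u g + f n := by
    intro n g
    obtain ⟨n', v, hv, e⟩ := hs g
    have e' : (s g)⁻¹ * (g * n) = ((n' * n : N) : G) * ((n : G)⁻¹ * v * n) := by
      rw [← mul_assoc, e, Subgroup.coe_mul]; group
    have hv' : (n : G)⁻¹ * v * n ∈ V.toSubgroup := by simpa using hVn.conj_mem v hv (n : G)⁻¹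
    simp only [u]
    rw [hsM g n ((le_sup_left : N ≤ M) n.2), e', hF _ _ hv', e, hF _ _ hv, hf]
  -- Left equivariance follows from right equivariance via `ng = g(g⁻¹ng)` and the invariance of `f`
  -- under conjugation.
  have hul : ∀ (n : N) (g : G), u (n * g) = f n + u g := by
    intro n g
    have e : (n : G) * g = g * (⟨g⁻¹ * n * g⁻¹⁻¹, hNn.conj_mem n n.2 g⁻¹⟩ : N) := by
      simp [mul_assoc]
    rw [e, hur, hinv, add_comm]
  have huV : ∀ (g : G), ∀ v ∈ V.toSubgroup, u (g * v) = u g := by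
    intro g v hv
    obtain ⟨n', v', hv', e⟩ := hs g
    simp only [u]
    rw [hsM g v ((le_sup_right : V.toSubgroup ≤ M) hv), ← mul_assoc, e, mul_assoc,
      hF _ _ (mul_mem hv' hv), hF _ _ hv']
  -- The representative of the trivial coset need not be 1, so `u 1` is subtracted to normalise;
  -- equivariance is unaffected by a constant.
  have hlc : IsLocallyConstant fun g => u g - u 1 := by
    refine (IsLocallyConstant.iff_exists_open _).2 fun g => ⟨(g * ·) '' (V.toSubgroup : Set G),
      isOpenMap_mul_left g _ V.isOpen', ⟨1, one_mem _, mul_one g⟩, ?_⟩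
    rintro _ ⟨v, hv, rfl⟩
    exact congrArg (· - u 1) (huV g v hv)
  exact ⟨⟨_, hlc⟩, sub_self _, fun n g => by simp [hul, add_sub_assoc],
    fun n g => by simp [hur]; abel⟩

end Characters

/-! ### The descending `q`-central sequence and functions equivariant under its terms. -/

section SeriesLemmas

variable {q : ℕ} {G : Type*} [Group G] [TopologicalSpace G] [IsTopologicalGroup G]

theorem descSeries_isClosed : ∀ i, IsClosed (descSeries q G i : Set G)
  | 0 => isClosed_univ
  | 1 => isClosed_univ
  | i + 2 => by rw [descSeries]; exact Subgroup.isClosed_topologicalClosure _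

theorem pow_mem_descSeries {i : ℕ} {h : G} (hh : h ∈ descSeries q G (i + 1)) :
    h ^ q ∈ descSeries q G (i + 2) := by
  rw [descSeries]
  exact Subgroup.le_topologicalClosure _ (Subgroup.subset_closure (Or.inl ⟨h, hh, rfl⟩))

theorem comm_mem_descSeries {i : ℕ} {h : G} (hh : h ∈ descSeries q G (i + 1)) (g : G) :
    h⁻¹ * g⁻¹ * h * g ∈ descSeries q G (i + 2) := by
  rw [descSeries]
  exact Subgroup.le_topologicalClosure _ (Subgroup.subset_closure (Or.inr ⟨h, hh, g, rfl⟩))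

theorem descSeries_le_of_isClosed {i : ℕ} {K : Subgroup G} (hK : IsClosed (K : Set G))
    (hpow : ∀ h ∈ descSeries q G (i + 1), h ^ q ∈ K)
    (hcomm : ∀ h ∈ descSeries q G (i + 1), ∀ g : G, h⁻¹ * g⁻¹ * h * g ∈ K) :
    descSeries q G (i + 2) ≤ K := by
  rw [descSeries]
  refine Subgroup.topologicalClosure_minimal _ ((Subgroup.closure_le _).2 ?_) hK
  rintro _ (⟨h, hh, rfl⟩ | ⟨h, hh, g, rfl⟩)
  exacts [hpow h hh, hcomm h hh g]

theorem descSeries_succ_le (i : ℕ) : descSeries q G (i + 2) ≤ descSeries q G (i + 1) := by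
  refine descSeries_le_of_isClosed (descSeries_isClosed _) (fun h hh => pow_mem hh q)
    fun h hh g => ?_
  have := (descSeries_normal q G (i + 1)).conj_mem h hh g⁻¹
  rw [mul_assoc, mul_assoc, ← mul_assoc g⁻¹]
  exact mul_mem (inv_mem hh) (by simpa using this)

theorem map_descSeries {G' : Type*} [Group G'] [TopologicalSpace G'] [IsTopologicalGroup G']
    (π : G →ₜ* G') {i : ℕ} {x : G} (hx : x ∈ descSeries q G i) : π x ∈ descSeries q G' i :=
  descSeries_le_comap q π i hx

/-- A continuous map to `ℤ/q` that is equivariant for translation by `G^{(i)}`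
vanishes on `G^{(i+1)}`. -/
theorem eq_zero_of_mem_descSeries (u : LocallyConstant G (ZMod q)) (i : ℕ)
    (hl : ∀ n ∈ descSeries q G (i + 1), ∀ g, u (n * g) = u n + u g)
    (hr : ∀ n ∈ descSeries q G (i + 1), ∀ g, u (g * n) = u g + u n)
    {x : G} (hx : x ∈ descSeries q G (i + 2)) : u x = 0 := by
  have h1 : u 1 = 0 := by simpa using hl 1 (one_mem _) 1
  have hinv : ∀ n ∈ descSeries q G (i + 1), u n⁻¹ = - u n := fun n hn => by
    rw [eq_neg_iff_add_eq_zero, ← hl _ (inv_mem hn), inv_mul_cancel, h1]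
  -- The zeros of `u` inside `G^{(i+1)}` form a closed subgroup, so only the generators `h^q` and
  -- `[h, g]` of `G^{(i+2)}` need checking.
  let K : Subgroup G :=
    { carrier := {x | x ∈ descSeries q G (i + 1) ∧ u x = 0}
      mul_mem' := fun {a b} ha hb => ⟨mul_mem ha.1 hb.1, by rw [hl _ ha.1, ha.2, hb.2, add_zero]⟩
      one_mem' := ⟨one_mem _, h1⟩
      inv_mem' := fun {a} ha => ⟨inv_mem ha.1, by rw [hinv _ ha.1, ha.2, neg_zero]⟩ }
  have hK : IsClosed (K : Set G) :=
    (descSeries_isClosed _).inter (u.isLocallyConstant.isClosed_fiber 0)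
  refine (descSeries_le_of_isClosed hK (fun h hh => ⟨pow_mem hh q, ?_⟩) (fun h hh g => ⟨?_, ?_⟩)
    hx : x ∈ K).2
  · have : ∀ k : ℕ, u (h ^ k) = k * u h := by
      intro k
      induction k with
      | zero => simp [h1]
      | succ k ih => rw [pow_succ, hr _ hh, ih]; push_cast; ring
    rw [this, ZMod.natCast_self, zero_mul]
  · exact descSeries_succ_le i (comm_mem_descSeries hh g)
  -- Evaluating `u` on both sides of `gh[h, g] = hg` leaves `u([h, g]) = 0`.
  · have e : g * (h * (h⁻¹ * g⁻¹ * h * g)) = h * g := by group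
    have hc := descSeries_succ_le i (comm_mem_descSeries hh g)
    have := congrArg u e
    rw [← mul_assoc, hr _ hc, hr _ hh, hl _ hh] at this
    linear_combination this

theorem hom_eq_zero_of_mem_descSeries (f : LocallyConstant G (ZMod q))
    (hf : ∀ a b, f (a * b) = f a + f b) (i : ℕ) {x : G} (hx : x ∈ descSeries q G (i + 2)) :
    f x = 0 :=
  eq_zero_of_mem_descSeries f i (fun _ _ _ => hf _ _) (fun _ _ _ => hf _ _) hx

theorem exists_hom_ne_zero [CompactSpace G] [T2Space G] [TotallyDisconnectedSpace G] [NeZero q]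
    {K : Subgroup G} (hK : IsClosed (K : Set G)) (hle : descSeries q G 2 ≤ K) {x : G}
    (hx : x ∉ K) :
    ∃ f : LocallyConstant G (ZMod q), (∀ a b, f (a * b) = f a + f b) ∧ (∀ n ∈ K, f n = 0) ∧
      f x ≠ 0 :=
  exists_character_of_notMem hK (fun _ => hle (pow_mem_descSeries (i := 0) trivial))
    (fun _ g => hle (comm_mem_descSeries (i := 0) trivial g)) hx

/-- Separation of points of `G^{(2)}` modulo `G^{(3)}` by cochains whose coboundary
comes from `G^{[2]}`. -/
theorem exists_cochain_ne_zero [CompactSpace G] [T2Space G] [TotallyDisconnectedSpace G]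
    [NeZero q] {x : G} (hx : x ∈ descSeries q G 2) (hx' : x ∉ descSeries q G 3) :
    ∃ u : LocallyConstant G (ZMod q), u 1 = 0 ∧ u x ≠ 0 ∧
      (∀ n ∈ descSeries q G 2, ∀ g, u (n * g) = u n + u g) ∧
      ∀ n ∈ descSeries q G 2, ∀ g, u (g * n) = u g + u n := by
  have : CompactSpace (descSeries q G 2) :=
    isCompact_iff_compactSpace.1 (descSeries_isClosed 2).isCompact
  -- The separation theorem is applied with `G^{(2)}` itself as the ambient profinite group.
  obtain ⟨f, hf, hf0, hfx⟩ := exists_character_of_notMem (q := q) (G := descSeries q G 2)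
    (N := (descSeries q G 3).subgroupOf (descSeries q G 2))
    ((descSeries_isClosed 3).preimage continuous_subtype_val)
    (fun h => Subgroup.mem_subgroupOf.2 (pow_mem_descSeries (i := 1) h.2))
    (fun h g => Subgroup.mem_subgroupOf.2 (comm_mem_descSeries (i := 1) h.2 g))
    (x := ⟨x, hx⟩) (fun h => hx' (Subgroup.mem_subgroupOf.1 h))
  -- The character is invariant since `gng⁻¹ = n[n, g⁻¹]` and `f` kills `G^{(3)}`.
  obtain ⟨u, hu1, hul, hur⟩ := exists_extension_of_invariant f hf fun n g => by
    have hc : (n : G)⁻¹ * g⁻¹⁻¹ * n * g⁻¹ ∈ descSeries q G 3 :=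
      comm_mem_descSeries (i := 1) n.2 g⁻¹
    have e : (⟨g * n * g⁻¹, (descSeries_normal q G 2).conj_mem n n.2 g⟩ : descSeries q G 2) =
        n * ⟨(n : G)⁻¹ * g⁻¹⁻¹ * n * g⁻¹, descSeries_succ_le 1 hc⟩ := by
      ext; simp; group
    rw [e, hf, hf0 ⟨_, descSeries_succ_le 1 hc⟩ (Subgroup.mem_subgroupOf.2 hc), add_zero]
  have huf : ∀ n : descSeries q G 2, u n = f n := fun n => by simpa [hu1] using hul n 1
  exact ⟨u, hu1, by rwa [huf ⟨x, hx⟩], fun n hn g => by rw [huf ⟨n, hn⟩]; exact hul ⟨n, hn⟩ g,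
    fun n hn g => by rw [huf ⟨n, hn⟩]; exact hur ⟨n, hn⟩ g⟩

end SeriesLemmas

/-! ### Descending cochains to quotients and transporting them to the other group. -/

section Descent

variable {q : ℕ} {G₁ : Type*} [Group G₁] [TopologicalSpace G₁] [IsTopologicalGroup G₁]
  {G₂ : Type*} [Group G₂] [TopologicalSpace G₂] [IsTopologicalGroup G₂]

/-- Transport of an invariant cochain along `G₂ → G₁/N`. -/
theorem exists_cochain_of_invariant {R : Type*} {N : Subgroup G₁} [N.Normal]
    (j : G₂ →ₜ* G₁ ⧸ N) {ι : Type*} [Finite ι] (f : LocallyConstant (ι → G₁) R)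
    (hf : ∀ x y : ι → G₁, (∀ i, (x i)⁻¹ * y i ∈ N) → f x = f y) :
    ∃ f' : LocallyConstant (ι → G₂) R,
      ∀ y (x : ι → G₁), (∀ i, j (y i) = (x i : G₁ ⧸ N)) → f' y = f x := by
  classical
  -- Openness is essential: a product of open quotient maps is again a quotient map, so local
  -- constancy can be tested on `ι → G₁`.
  have hq : IsOpenQuotientMap (Pi.map fun _ : ι => ((↑) : G₁ → G₁ ⧸ N)) :=
    IsOpenQuotientMap.piMap fun _ => QuotientGroup.isOpenQuotientMap_mk
  let F : (ι → G₁ ⧸ N) → R := fun z => f fun i => (z i).out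
  have hF : ∀ x : ι → G₁, F (Pi.map (fun _ => ((↑) : G₁ → G₁ ⧸ N)) x) = f x := fun x =>
    hf _ _ fun i => QuotientGroup.eq.1 (QuotientGroup.out_eq' _)
  have hlc : IsLocallyConstant F := fun s => by
    rw [← hq.isQuotientMap.isOpen_preimage, ← Set.preimage_comp]
    rw [show F ∘ Pi.map (fun _ : ι => ((↑) : G₁ → G₁ ⧸ N)) = f from funext hF]
    exact f.isLocallyConstant s
  refine ⟨(⟨F, hlc⟩ : LocallyConstant (ι → G₁ ⧸ N) R).comap
    
    ⟨fun y i => j (y i), continuous_pi fun i => j.continuous_toFun.comp (continuous_apply i)⟩, fun y x h => ?_⟩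
  rw [← hF x]
  exact congrArg F (funext h)

theorem exists_of_invariant {R : Type*} {N : Subgroup G₁} [N.Normal]
    (j : G₂ →ₜ* G₁ ⧸ N) (f : LocallyConstant G₁ R) (hf : ∀ x y : G₁, x⁻¹ * y ∈ N → f x = f y) :
    ∃ f' : LocallyConstant G₂ R, ∀ y (x : G₁), j y = (x : G₁ ⧸ N) → f' y = f x := by
  obtain ⟨f', hf'⟩ := exists_cochain_of_invariant j (ι := Unit)
    (f.comap ⟨fun x => x (), by fun_prop⟩) fun x y h => hf _ _ (h ())
  exact ⟨f'.comap ⟨fun x _ => x, by fun_prop⟩, 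
    fun y x h => hf' (fun _ => y) (fun _ => x) fun _ => h⟩

/-- A continuous bijection from a compact space to a Hausdorff space is a homeomorphism; the target
is Hausdorff because `G₂^{(i)}` is closed. -/
theorem exists_continuousMulEquiv [CompactSpace G₁] (π : G₁ →ₜ* G₂) (i : ℕ)
    (h : Function.Bijective (descQuotMap q π i)) :
    ∃ e : descQuot q G₁ i ≃ₜ* descQuot q G₂ i, ∀ x, e x = descQuotMap q π i x := by
  have : IsClosed (descSeries q G₂ i : Set G₂) := descSeries_isClosed i
  have : T2Space (descQuot q G₂ i) := inferInstance
  let e := MulEquiv.ofBijective (descQuotMap q π i) h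
  have hc : Continuous e.toEquiv := (descQuotMap q π i).continuous_toFun
  exact ⟨{ e with
    continuous_toFun := hc
    continuous_invFun := (hc.homeoOfEquivCompactToT2).continuous_invFun }, fun x => rfl⟩

/-- A section up to level `i` of `π`, when `π^{[i]}` is an isomorphism. -/
theorem exists_descQuot_section (π : G₁ →ₜ* G₂) (i : ℕ)
    (e : descQuot q G₁ i ≃ₜ* descQuot q G₂ i) (he : ∀ x, e x = descQuotMap q π i x) :
    ∃ j : G₂ →ₜ* descQuot q G₁ i, (∀ x : G₁, j (π x) = x) ∧
      ∀ y (x : G₁), j y = (x : descQuot q G₁ i) ↔ y⁻¹ * π x ∈ descSeries q G₂ i := by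
  have hm : ∀ x : G₁, e x = (π x : descQuot q G₂ i) := fun x => he x
  refine ⟨⟨(e.symm : descQuot q G₂ i →* _).comp (QuotientGroup.mk' _),
    e.symm.continuous.comp continuous_quot_mk⟩, fun x => ?_, fun y x => ?_⟩
  · exact (congrArg e.symm (hm x)).symm.trans (e.symm_apply_apply _)
  · rw [← QuotientGroup.eq, ← hm]
    exact e.symm_apply_eq

end Descent

/-! ### `H^1` as continuous homomorphisms. -/

section DegreeOne

variable {R : Type*} [CommRing R] {G : Type*} [Group G] [TopologicalSpace G]

/-- A locally constant map as a `1`-cochain. -/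
def toCochain (f : LocallyConstant G R) : Cochain R G 1 := f.comap ⟨fun x => x 0, by fun_prop⟩

/-- A `1`-cochain as a locally constant map. -/
def ofCochain (f : Cochain R G 1) : LocallyConstant G R := f.comap ⟨fun x _ => x, by fun_prop⟩

theorem toCochain_apply (f : LocallyConstant G R) (x : Fin 1 → G) : toCochain f x = f (x 0) := rfl

theorem toCochain_ofCochain (f : Cochain R G 1) : toCochain (ofCochain f) = f := by
  ext x
  exact congrArg f (funext fun i => congrArg x (Subsingleton.elim _ _))

variable [IsTopologicalGroup G]

theorem d_one_apply (f : LocallyConstant G R) (z : Fin 2 → G) :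
    d R G 1 (toCochain f) z = f (z 1) - f (z 0 * z 1) + f (z 0) := by
  rw [d_apply, Fin.sum_univ_two]
  simp only [toCochain_apply]
  have h2 : Fin.contractNth (0 : Fin 2) (· * ·) z 0 = z 0 * z 1 := by simp [Fin.contractNth]
  have h3 : Fin.contractNth (1 : Fin 2) (· * ·) z 0 = z 0 := by simp [Fin.contractNth]
  rw [h2, h3]
  simp
  ring

theorem toCochain_mem_cocycles {f : LocallyConstant G R} (hf : ∀ a b, f (a * b) = f a + f b) :
    toCochain f ∈ cocycles R G 1 := by
  refine LocallyConstant.ext fun z => ?_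
  rw [d_one_apply, hf]
  simp

/-- For trivial action the two terms of the coboundary in degree 0 cancel. Degree-one classes are
thus homomorphisms, with no quotient to take. -/
theorem coboundaries_one : coboundaries R G 1 = ⊥ := by
  refine eq_bot_iff.2 ?_
  rintro _ ⟨c, rfl⟩
  refine LocallyConstant.ext fun x => ?_
  rw [d_apply]
  simp only [Fin.sum_univ_succ, Finset.univ_eq_empty, Finset.sum_empty]
  rw [Subsingleton.elim (fun i => x (Fin.succ i)) (Fin.contractNth 0 (· * ·) x)]
  simp

variable {G' : Type*} [Group G'] [TopologicalSpace G'] [IsTopologicalGroup G']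

theorem map_one_injective_iff (π : G →ₜ* G') :
    Function.Injective (H.map R π 1) ↔ ∀ f : LocallyConstant G' R,
      (∀ a b, f (a * b) = f a + f b) → (∀ x, f (π x) = 0) → ∀ y, f y = 0 := by
  rw [← LinearMap.ker_eq_bot, LinearMap.ker_eq_bot']
  constructor
  · intro h f hf h0 y
    have := h (H.mk R G' 1 ⟨toCochain f, toCochain_mem_cocycles hf⟩) (by
      rw [H.map_mk, ← map_zero (H.mk R G 1)]
      refine congrArg _ (Subtype.ext (LocallyConstant.ext fun x => h0 (x 0))))
    rw [← map_zero (H.mk R G' 1), H.mk_eq_mk, coboundaries_one] at this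
    have := DFunLike.congr_fun ((Submodule.mem_bot R).1 this) (fun _ => y)
    simpa [toCochain_apply] using this
  · intro h a ha
    obtain ⟨a, rfl⟩ := H.mk_surjective a
    rw [H.map_mk, ← map_zero (H.mk R G 1), H.mk_eq_mk, coboundaries_one] at ha
    rw [← map_zero (H.mk R G' 1)]
    refine congrArg _ (Subtype.ext ?_)
    rw [← toCochain_ofCochain a.1]
    refine LocallyConstant.ext fun y => h (ofCochain a.1)
      (fun x y => cocycles_one_apply a.2 x y) (fun x => ?_) (y 0)
    have := DFunLike.congr_fun (sub_eq_zero.1 ((Submodule.mem_bot R).1 ha)) (fun _ => x)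
    exact this

theorem map_one_surjective_iff (π : G →ₜ* G') :
    Function.Surjective (H.map R π 1) ↔ ∀ f : LocallyConstant G R,
      (∀ a b, f (a * b) = f a + f b) →
      ∃ f' : LocallyConstant G' R, (∀ a b, f' (a * b) = f' a + f' b) ∧ ∀ x, f' (π x) = f x := by
  constructor
  · intro h f hf
    obtain ⟨a, ha⟩ := h (H.mk R G 1 ⟨toCochain f, toCochain_mem_cocycles hf⟩)
    obtain ⟨a, rfl⟩ := H.mk_surjective a
    rw [H.map_mk, H.mk_eq_mk, coboundaries_one] at ha
    refine ⟨ofCochain a.1, fun x y => cocycles_one_apply a.2 x y, fun x => ?_⟩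
    have := DFunLike.congr_fun (sub_eq_zero.1 ((Submodule.mem_bot R).1 ha)) (fun _ => x)
    exact this
  · intro h b
    obtain ⟨b, rfl⟩ := H.mk_surjective b
    obtain ⟨f, hf, hfb⟩ := h (ofCochain b.1) fun x y => cocycles_one_apply b.2 x y
    refine ⟨H.mk R G' 1 ⟨toCochain f, toCochain_mem_cocycles hf⟩, ?_⟩
    rw [H.map_mk]
    refine congrArg _ (Subtype.ext ?_)
    rw [← toCochain_ofCochain b.1]
    exact LocallyConstant.ext fun x => hfb (x 0)

end DegreeOne

/-! ### The equivalence of (a) and (b). -/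

section Main

variable {q : ℕ}
  {G₁ : Type*} [Group G₁] [TopologicalSpace G₁] [IsTopologicalGroup G₁]
  {G₂ : Type*} [Group G₂] [TopologicalSpace G₂] [IsTopologicalGroup G₂]
  (π : G₁ →ₜ* G₂)

/-- A class of degree two that is decomposable comes from `G^{[2]}`. -/
theorem exists_cocycle_of_mem_decPart {z : H (ZMod q) G₂ 2}
    (hz : z ∈ decPart (ZMod q) (H (ZMod q) G₂) 2) :
    ∃ c : cocycles (ZMod q) G₂ 2, H.mk (ZMod q) G₂ 2 c = z ∧
      (∀ x y : Fin 2 → G₂, (∀ i, (x i)⁻¹ * y i ∈ descSeries q G₂ 2) → c.1 x = c.1 y) ∧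
      ∀ x : Fin 2 → G₂, (∃ i, x i ∈ descSeries q G₂ 2) → c.1 x = 0 := by
  -- All three requirements are stable under linear combinations, so only cup products `f ∪ g` of
  -- homomorphisms matter; their value `f(x)g(y)` depends on `x`, `y` modulo `G₂^{(2)}`.
  induction hz using Submodule.span_induction with
  | mem z hz =>
    obtain ⟨a, ha⟩ := hz
    obtain ⟨f, hf⟩ := H.mk_surjective (a 0)
    obtain ⟨g, hg⟩ := H.mk_surjective (a 1)
    have e : z = GradedMonoid.GMul.mul (a 0) (a 1) := by
      refine DirectSum.of_injective 2 (ha.trans ?_)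
      simpa using DirectSum.of_mul_of (a 0) (a 1)
    have h0 : ∀ (f : cocycles (ZMod q) G₂ 1) (x : G₂), x ∈ descSeries q G₂ 2 →
        f.1 (fun _ => x) = 0 := fun f x hx =>
      hom_eq_zero_of_mem_descSeries (ofCochain f.1) (fun a b => cocycles_one_apply f.2 a b) 0 hx
    have hi : ∀ (f : cocycles (ZMod q) G₂ 1) (x y : G₂), x⁻¹ * y ∈ descSeries q G₂ 2 →
        f.1 (fun _ => x) = f.1 (fun _ => y) := fun f x y h => by
      have := cocycles_one_apply f.2 x (x⁻¹ * y)
      rw [h0 f _ h, add_zero, mul_inv_cancel_left] at this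
      exact this.symm
    have hc : ∀ x : Fin 2 → G₂, cup (rfl : 1 + 1 = 2) f.1 g.1 x =
        f.1 (fun _ => x 0) * g.1 (fun _ => x 1) := fun x => by
      rw [cup_apply]
      refine congrArg₂ (· * ·) (congrArg f.1 ?_) (congrArg g.1 ?_)
      · funext i; fin_cases i; rfl
      · funext i; fin_cases i; rfl
    refine ⟨⟨cup rfl f.1 g.1, cup_mem_cocycles rfl f.2 g.2⟩, ?_, fun x y h => ?_, ?_⟩
    · rw [e, ← hf, ← hg, H.mk_mul_mk]
    · rw [hc, hc, hi f _ _ (h 0), hi g _ _ (h 1)]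
    · rintro x ⟨i, hx⟩
      rw [hc]
      fin_cases i
      · exact (congrArg (· * _) (h0 f _ hx)).trans (zero_mul _)
      · exact (congrArg (_ * ·) (h0 g _ hx)).trans (mul_zero _)
  | zero => exact ⟨0, map_zero _, fun _ _ _ => rfl, fun _ _ => rfl⟩
  | add z z' _ _ h h' =>
    obtain ⟨c, rfl, hc, hc0⟩ := h
    obtain ⟨c', rfl, hc', hc0'⟩ := h'
    refine ⟨c + c', map_add _ _ _, fun x y h => ?_, fun x h => ?_⟩
    · exact congrArg₂ (· + ·) (hc x y h) (hc' x y h)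
    · exact (congrArg₂ (· + ·) (hc0 x h) (hc0' x h)).trans (add_zero 0)
  | smul r z _ h =>
    obtain ⟨c, rfl, hc, hc0⟩ := h
    refine ⟨r • c, map_smul _ _ _, fun x y h => ?_, fun x h => ?_⟩
    · exact congrArg (r • ·) (hc x y h)
    · exact (congrArg (r • ·) (hc0 x h)).trans (smul_zero r)

/-- Homomorphisms to `ℤ/q` vanish on the third term of the series, so those of `G₁` and of `G₂` are
those of the common quotient. -/
theorem map_one_bijective_of_equiv (e : descQuot q G₁ 3 ≃ₜ* descQuot q G₂ 3)
    (he : ∀ x, e x = descQuotMap q π 3 x) : Function.Bijective (H.map (ZMod q) π 1) := by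
  obtain ⟨j, hj, hj'⟩ := exists_descQuot_section π 3 e he
  refine ⟨(map_one_injective_iff π).2 fun f hf h0 y => ?_,
    (map_one_surjective_iff π).2 fun f hf => ?_⟩
  · obtain ⟨x, hx⟩ := QuotientGroup.mk_surjective (j y)
    have h := hom_eq_zero_of_mem_descSeries f hf 1 ((hj' y x).1 hx.symm)
    have := hf y (y⁻¹ * π x)
    rw [mul_inv_cancel_left, h0, h, add_zero] at this
    exact this.symm
  · obtain ⟨f', hf'⟩ := exists_of_invariant (N := descSeries q G₁ 3) j f fun x y h => by
      have := hf x (x⁻¹ * y)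
      rw [mul_inv_cancel_left, hom_eq_zero_of_mem_descSeries f hf 1 h, add_zero] at this
      exact this.symm
    refine ⟨f', fun a b => ?_, fun x => hf' _ _ (hj x)⟩
    obtain ⟨x, hx⟩ := QuotientGroup.mk_surjective (j a)
    obtain ⟨y, hy⟩ := QuotientGroup.mk_surjective (j b)
    rw [hf' a x hx.symm, hf' b y hy.symm, hf' (a * b) (x * y), hf]
    rw [map_mul, ← hx, ← hy]
    rfl

/-- A cochain on `G₁` bounding the pullback of a well-chosen cocycle is equivariant under
`G₁^{(2)}`, hence factors through `G₁^{[3]}` and transports to `G₂`. -/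
theorem map_two_injective_of_equiv (hG₂ : IsDecomposableIn (ZMod q) (H (ZMod q) G₂) 2)
    (e : descQuot q G₁ 3 ≃ₜ* descQuot q G₂ 3) (he : ∀ x, e x = descQuotMap q π 3 x) :
    Function.Injective (H.map (ZMod q) π 2) := by
  obtain ⟨j, hj, hj'⟩ := exists_descQuot_section π 3 e he
  rw [← LinearMap.ker_eq_bot, LinearMap.ker_eq_bot']
  intro z hz
  obtain ⟨c, rfl, hc, hc0⟩ := exists_cocycle_of_mem_decPart
    (show z ∈ decPart (ZMod q) (H (ZMod q) G₂) 2 from hG₂ ▸ Submodule.mem_top)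
  rw [H.map_mk, ← map_zero (H.mk (ZMod q) G₁ 2), H.mk_eq_mk] at hz
  obtain ⟨u, hu⟩ := hz
  rw [← toCochain_ofCochain u] at hu
  set u := ofCochain u
  have hu' : ∀ x y : G₁, u y - u (x * y) + u x = c.1 ![π x, π y] := fun x y => by
    have := DFunLike.congr_fun hu ![x, y]
    rw [d_one_apply] at this
    refine this.trans ((sub_zero _).trans (congrArg c.1 ?_))
    funext i
    fin_cases i <;> rfl
  have hul : ∀ n ∈ descSeries q G₁ 2, ∀ g, u (n * g) = u n + u g := fun n hn g => by
    have := hu' n g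
    rw [hc0 _ ⟨0, map_descSeries π hn⟩] at this
    linear_combination -this
  have hur : ∀ n ∈ descSeries q G₁ 2, ∀ g, u (g * n) = u g + u n := fun n hn g => by
    have := hu' g n
    rw [hc0 _ ⟨1, map_descSeries π hn⟩] at this
    linear_combination -this
  obtain ⟨v, hv⟩ := exists_of_invariant (N := descSeries q G₁ 3) j u fun x y h => by
    have := hur _ (descSeries_succ_le 1 h) x
    rw [mul_inv_cancel_left, eq_zero_of_mem_descSeries u 1 hul hur h, add_zero] at this
    exact this.symm
  rw [← map_zero (H.mk (ZMod q) G₂ 2), H.mk_eq_mk]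
  refine ⟨toCochain v, LocallyConstant.ext fun z => ?_⟩
  obtain ⟨x, hx⟩ := QuotientGroup.mk_surjective (j (z 0))
  obtain ⟨y, hy⟩ := QuotientGroup.mk_surjective (j (z 1))
  have hxy : j (z 0 * z 1) = ((x * y : G₁) : descQuot q G₁ 3) := by
    rw [map_mul, ← hx, ← hy]; rfl
  rw [d_one_apply, hv _ x hx.symm, hv _ y hy.symm, hv _ _ hxy, hu']
  -- The lifts `x`, `y` match `z 0`, `z 1` only modulo `G₂^{(3)}`, but `c` depends on its arguments
  -- only modulo the larger `G₂^{(2)}`.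
  refine (hc _ _ fun i => ?_).symm.trans (sub_zero _).symm
  fin_cases i
  · exact descSeries_succ_le 1 ((hj' _ _).1 hx.symm)
  · exact descSeries_succ_le 1 ((hj' _ _).1 hy.symm)

section Surjective

variable [CompactSpace G₁]

theorem isClosed_range_comap_mk (i : ℕ) :
    IsClosed (((descQuotMap q π i : descQuot q G₁ i →* descQuot q G₂ i).range.comap
      (QuotientGroup.mk' (descSeries q G₂ i)) : Subgroup G₂) : Set G₂) := by
  have : IsClosed (descSeries q G₂ i : Set G₂) := descSeries_isClosed i
  have hr : IsClosed (Set.range (descQuotMap q π i)) :=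
    (isCompact_range (descQuotMap q π i).continuous_toFun).isClosed
  exact hr.preimage continuous_quot_mk

/-- A point outside the closed image would be detected by a nonzero character of `G₂` that dies on
`G₁`. -/
theorem descQuotMap_two_surjective [CompactSpace G₂] [T2Space G₂] [TotallyDisconnectedSpace G₂]
    [NeZero q] (h : Function.Injective (H.map (ZMod q) π 1)) :
    Function.Surjective (descQuotMap q π 2) := by
  intro y
  obtain ⟨y, rfl⟩ := QuotientGroup.mk_surjective y
  by_contra hy
  obtain ⟨f, hf, hfK, hfy⟩ := exists_hom_ne_zero (isClosed_range_comap_mk (q := q) π 2)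
    (fun n hn => ⟨1, (map_one _).trans ((QuotientGroup.eq_one_iff n).2 hn).symm⟩) (x := y) hy
  exact hfy ((map_one_injective_iff π).1 h f hf (fun x => hfK _ ⟨x, rfl⟩) y)

/-- Here `G₂ = π(G₁)G₂^{(2)}`, and modulo `G₂^{(3)}` the subgroup `G₂^{(2)}` is central and killed
by `q`. Hence `q`-th powers and commutators in `G₂` agree modulo `G₂^{(3)}` with those of elements
of `π(G₁)`, so the image contains `G₂^{(2)}` and then everything. -/
theorem descQuotMap_three_surjective (h : Function.Surjective (descQuotMap q π 2)) :
    Function.Surjective (descQuotMap q π 3) := by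
  let N := descSeries q G₂ 3
  have hdec : ∀ y : G₂, ∃ x, ∃ c ∈ descSeries q G₂ 2, y = π x * c := fun y => by
    obtain ⟨x, hx⟩ := h (y : descQuot q G₂ 2)
    obtain ⟨x, rfl⟩ := QuotientGroup.mk_surjective x
    exact ⟨x, (π x)⁻¹ * y, QuotientGroup.eq.1 hx, (mul_inv_cancel_left _ _).symm⟩
  have hcentral : ∀ c ∈ descSeries q G₂ 2, ∀ g : G₂ ⧸ N, Commute (c : G₂ ⧸ N) g := fun c hc g => by
    obtain ⟨g, rfl⟩ := QuotientGroup.mk_surjective g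
    refine (QuotientGroup.eq.2 ?_ : ((g * c : G₂) : G₂ ⧸ N) = (c * g : G₂)).symm
    have e : (g * c)⁻¹ * (c * g) = c⁻¹ * g⁻¹ * c * g := by group
    exact e ▸ comm_mem_descSeries (i := 1) hc g
  set K := (descQuotMap q π 3 : descQuot q G₁ 3 →* descQuot q G₂ 3).range with hK
  have hmem : ∀ x : G₁, ((π x : G₂) : G₂ ⧸ N) ∈ K := fun x => ⟨x, rfl⟩
  have hle : descSeries q G₂ 2 ≤ K.comap (QuotientGroup.mk' N) := by
    refine descSeries_le_of_isClosed (isClosed_range_comap_mk π 3) (fun y _ => ?_) fun y _ z => ?_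
    · obtain ⟨x, c, hc, rfl⟩ := hdec y
      have e : QuotientGroup.mk' N ((π x * c) ^ q) = (π x : G₂ ⧸ N) ^ q := by
        have hcq : (c : G₂ ⧸ N) ^ q = 1 :=
          (QuotientGroup.eq_one_iff (N := N) _).2 (pow_mem_descSeries (i := 1) hc)
        rw [map_pow, map_mul]
        exact ((hcentral c hc _).symm.mul_pow q).trans ((congrArg (_ * ·) hcq).trans (mul_one _))
      rw [Subgroup.mem_comap, e]
      exact pow_mem (hmem x) q
    · obtain ⟨x, c, hc, rfl⟩ := hdec y
      obtain ⟨x', c', hc', rfl⟩ := hdec z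
      -- A commutator does not change when its entries are multiplied by central elements.
      have key : ∀ a b c d : G₂ ⧸ N, (∀ g, Commute c g) → (∀ g, Commute d g) →
          (a * c)⁻¹ * (b * d)⁻¹ * (a * c) * (b * d) = a⁻¹ * b⁻¹ * a * b := by
        intro a b c d hc hd
        rw [← (hc a).eq, ← (hd b).eq, mul_inv_rev, mul_inv_rev]
        have h1 : a⁻¹ * c⁻¹ * (b⁻¹ * d⁻¹) * (c * a) * (d * b) =
            a⁻¹ * (c⁻¹ * ((b⁻¹ * d⁻¹) * c)) * (a * d) * b := by group
        rw [h1, ← (hc _).eq, inv_mul_cancel_left, ← (hd a).eq]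
        group
      rw [Subgroup.mem_comap]
      refine Set.mem_of_eq_of_mem
        (key (π x) (π x') c c' (hcentral c hc) (hcentral c' hc')) ?_
      exact mul_mem (mul_mem (mul_mem (inv_mem (hmem x)) (inv_mem (hmem x'))) (hmem x)) (hmem x')
  intro y
  obtain ⟨y, rfl⟩ := QuotientGroup.mk_surjective y
  obtain ⟨x, c, hc, rfl⟩ := hdec y
  exact mul_mem (hmem x) (hle hc)

end Surjective

variable [CompactSpace G₁] [T2Space G₁] [TotallyDisconnectedSpace G₁] [NeZero q]

/-- A character of `G₁` nonzero at `x` would come from one of `G₂`, which must vanish at `π x`. -/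
theorem mem_descSeries_two_of_map (h : Function.Surjective (H.map (ZMod q) π 1)) {x : G₁}
    (hx : π x ∈ descSeries q G₂ 2) : x ∈ descSeries q G₁ 2 := by
  by_contra hx'
  obtain ⟨f, hf, _, hfx⟩ := exists_hom_ne_zero (descSeries_isClosed 2) le_rfl hx'
  obtain ⟨f', hf', hff'⟩ := (map_one_surjective_iff π).1 h f hf
  exact hfx (hff' x ▸ hom_eq_zero_of_mem_descSeries f' hf' 0 hx)

theorem descQuotMap_two_bijective [CompactSpace G₂] [T2Space G₂] [TotallyDisconnectedSpace G₂]
    (h : Function.Bijective (H.map (ZMod q) π 1)) : Function.Bijective (descQuotMap q π 2) := by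
  refine ⟨(injective_iff_map_eq_one _).2 fun x hx => ?_, descQuotMap_two_surjective π h.1⟩
  obtain ⟨x, rfl⟩ := QuotientGroup.mk_surjective x
  exact (QuotientGroup.eq_one_iff x).2
    (mem_descSeries_two_of_map π h.2 ((QuotientGroup.eq_one_iff _).1 hx))

/-- This replaces the comparison of five-term sequences: an equivariant function detecting `x`
extends along `π` to an equivariant function on `G₂`, which cannot detect `π x`. -/
theorem mem_descSeries_three_of_map [CompactSpace G₂] [T2Space G₂] [TotallyDisconnectedSpace G₂]
    (h1 : Function.Bijective (H.map (ZMod q) π 1)) (h2 : Function.Injective (H.map (ZMod q) π 2))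
    {x : G₁} (hx : π x ∈ descSeries q G₂ 3) : x ∈ descSeries q G₁ 3 := by
  by_contra hx3
  obtain ⟨u, hu1, hux, hul, hur⟩ := exists_cochain_ne_zero
    (mem_descSeries_two_of_map π h1.2 (descSeries_succ_le 1 hx)) hx3
  obtain ⟨e, he⟩ := exists_continuousMulEquiv π 2 (descQuotMap_two_bijective π h1)
  obtain ⟨j, hj, hj'⟩ := exists_descQuot_section π 2 e he
  -- the coboundary of `u` descends to a cocycle `w` of `G₂`
  have hinv : ∀ a b : Fin 2 → G₁, (∀ i, (a i)⁻¹ * b i ∈ descSeries q G₁ 2) →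
      d (ZMod q) G₁ 1 (toCochain u) a = d (ZMod q) G₁ 1 (toCochain u) b := by
    intro a b hab
    obtain ⟨m, hm, hb0⟩ : ∃ m ∈ descSeries q G₁ 2, b 0 = a 0 * m :=
      ⟨_, hab 0, (mul_inv_cancel_left _ _).symm⟩
    obtain ⟨n, hn, hb1⟩ : ∃ n ∈ descSeries q G₁ 2, b 1 = a 1 * n :=
      ⟨_, hab 1, (mul_inv_cancel_left _ _).symm⟩
    -- The factor `m` in the middle is moved to the left by conjugation with `a 0`, which does not
    -- change the value of `u` on it.
    have e1 : u (a 0 * m * (a 1 * n)) = u (a 0 * a 1) + u m + u n := by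
      have hm' : a 0 * m * (a 0)⁻¹ ∈ descSeries q G₁ 2 :=
        (descSeries_normal q G₁ 2).conj_mem m hm (a 0)
      have e2 : u (a 0 * m * (a 0)⁻¹) = u m := by
        have := hul _ hm' (a 0)
        rw [inv_mul_cancel_right, hur _ hm] at this
        linear_combination -this
      rw [← mul_assoc, hur _ hn, show a 0 * m * a 1 = a 0 * m * (a 0)⁻¹ * (a 0 * a 1) by group,
        hul _ hm', e2]
      ring
    rw [d_one_apply, d_one_apply, hb0, hb1, e1, hur _ hm, hur _ hn]
    ring
  obtain ⟨w, hw⟩ := exists_cochain_of_invariant (N := descSeries q G₁ 2) j _ hinv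
  have hlift : ∀ y : G₂, ∃ a : G₁, j y = (a : descQuot q G₁ 2) := fun y =>
    (QuotientGroup.mk_surjective (j y)).imp fun _ h => h.symm
  have hwπ : cochainMap (ZMod q) π 2 w = d (ZMod q) G₁ 1 (toCochain u) :=
    LocallyConstant.ext fun a => hw _ a fun i => hj (a i)
  -- On lifts to `G₁` of the arguments, the cocycle identity for `w` becomes `d(du) = 0`.
  have hwc : w ∈ cocycles (ZMod q) G₂ 2 := by
    refine LocallyConstant.ext fun y => ?_
    choose a ha using fun i => hlift (y i)
    have h0 : d (ZMod q) G₁ 2 (d (ZMod q) G₁ 1 (toCochain u)) a = 0 := by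
      rw [d_apply, Fin.sum_univ_three]
      simp only [d_one_apply]
      simp [Fin.contractNth, mul_assoc]
      ring
    refine Eq.trans ?_ h0
    rw [d_apply, d_apply]
    congr! 3 with k _ k
    · exact hw _ _ fun i => ha _
    · refine hw _ _ fun i => ?_
      unfold Fin.contractNth
      split_ifs
      · exact ha _
      · rw [map_mul, ha, ha]; rfl
      · exact ha _
  have hzero : H.mk (ZMod q) G₂ 2 ⟨w, hwc⟩ = 0 := by
    refine h2 ?_
    rw [map_zero, H.map_mk, ← map_zero (H.mk (ZMod q) G₁ 2), H.mk_eq_mk]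
    exact ⟨toCochain u, by rw [← hwπ]; exact (sub_zero _).symm⟩
  rw [← map_zero (H.mk (ZMod q) G₂ 2), H.mk_eq_mk] at hzero
  obtain ⟨v, hv⟩ := hzero
  rw [← toCochain_ofCochain v] at hv
  set v := ofCochain v
  have hv' : ∀ y z, v z - v (y * z) + v y = w ![y, z] := fun y z => by
    have := DFunLike.congr_fun hv ![y, z]
    rw [d_one_apply] at this
    exact this.trans (sub_zero _)
  have hu' : ∀ a b, u b - u (a * b) + u a = w ![π a, π b] := fun a b => by
    rw [hw _ ![a, b] fun i => by fin_cases i <;> exact hj _, d_one_apply]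
    rfl
  -- adjust `v` by a character to extend `u`
  let φ : LocallyConstant G₁ (ZMod q) := v.comap ⟨π, π.continuous_toFun⟩ - u
  have hφ : ∀ a, φ a = v (π a) - u a := fun a => rfl
  -- `φ = v ∘ π - u` is additive because both terms have the coboundary `π^*w`; surjectivity in
  -- degree 1 extends it to `G₂`.
  obtain ⟨f, hf, hfφ⟩ := (map_one_surjective_iff π).1 h1.2 φ fun a b => by
    have e1 := hv' (π a) (π b)
    have e2 := hu' a b
    rw [hφ, hφ, hφ, map_mul]
    linear_combination e2 - e1
  let t : LocallyConstant G₂ (ZMod q) := v - f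
  have ht : ∀ y, t y = v y - f y := fun y => rfl
  have htπ : ∀ a, t (π a) = u a := fun a => by rw [ht, hfφ, hφ]; ring
  have ht' : ∀ y z, t z - t (y * z) + t y = w ![y, z] := fun y z => by
    rw [← hv', ht, ht, ht, hf]; ring
  -- Elements of `G₂^{(2)}` may be lifted to `1`. Since `du(1, a) = du(a, 1) = u(1) = 0`, the
  -- cocycle `w = dt` vanishes when an argument lies in `G₂^{(2)}`, which gives the equivariance of
  -- `t`.
  have hj1 : ∀ n ∈ descSeries q G₂ 2, j n = ((1 : G₁) : descQuot q G₁ 2) := fun n hn =>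
    (hj' n 1).2 (by simpa using hn)
  have htl : ∀ n ∈ descSeries q G₂ 2, ∀ g, t (n * g) = t n + t g := fun n hn g => by
    obtain ⟨a, ha⟩ := hlift g
    have := ht' n g
    rw [hw _ ![1, a] fun i => by fin_cases i; exacts [hj1 n hn, ha], d_one_apply] at this
    simp [hu1] at this
    linear_combination -this
  have htr : ∀ n ∈ descSeries q G₂ 2, ∀ g, t (g * n) = t g + t n := fun n hn g => by
    obtain ⟨a, ha⟩ := hlift g
    have := ht' g n
    rw [hw _ ![a, 1] fun i => by fin_cases i; exacts [ha, hj1 n hn], d_one_apply] at this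
    simp [hu1] at this
    linear_combination -this
  exact hux (htπ x ▸ eq_zero_of_mem_descSeries t 1 htl htr hx)

theorem exists_equiv_of_bijective_of_injective [CompactSpace G₂] [T2Space G₂]
    [TotallyDisconnectedSpace G₂] (h1 : Function.Bijective (H.map (ZMod q) π 1))
    (h2 : Function.Injective (H.map (ZMod q) π 2)) :
    ∃ e : descQuot q G₁ 3 ≃ₜ* descQuot q G₂ 3, ∀ x, e x = descQuotMap q π 3 x := by
  refine exists_continuousMulEquiv π 3 ⟨(injective_iff_map_eq_one _).2 fun x hx => ?_,
    descQuotMap_three_surjective π (descQuotMap_two_surjective π h1.1)⟩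
  obtain ⟨x, rfl⟩ := QuotientGroup.mk_surjective x
  exact (QuotientGroup.eq_one_iff x).2
    (mem_descSeries_three_of_map π h1 h2 ((QuotientGroup.eq_one_iff _).1 hx))

end Main

end QuadCoh

end

open QuadCoh in
theorem theorem6p3 (p d : ℕ) (hp : p.Prime) (hd : 1 ≤ d)
    {G₁ : Type*} [Group G₁] [TopologicalSpace G₁] [IsTopologicalGroup G₁]
    [CompactSpace G₁] [T2Space G₁] [TotallyDisconnectedSpace G₁]
    {G₂ : Type*} [Group G₂] [TopologicalSpace G₂] [IsTopologicalGroup G₂]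
    [CompactSpace G₂] [T2Space G₂] [TotallyDisconnectedSpace G₂]
    (π : G₁ →ₜ* G₂)
    (hG₁ : IsQuadratic (ZMod (p ^ d)) (H (ZMod (p ^ d)) G₁))
    (hG₂ : IsDecomposableIn (ZMod (p ^ d)) (H (ZMod (p ^ d)) G₂) 2) :
    List.TFAE [
      Function.Bijective (H.map (ZMod (p ^ d)) π 1) ∧
        Function.Injective (H.map (ZMod (p ^ d)) π 2),
      ∃ e : descQuot (p ^ d) G₁ 3 ≃ₜ* descQuot (p ^ d) G₂ 3,
        ∀ x, e x = descQuotMap (p ^ d) π 3 x,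
      Function.Bijective (pullback (ZMod (p ^ d)) π).hull,
      Function.Bijective (pullback (ZMod (p ^ d)) π).dec] := by
  have : NeZero (p ^ d) := ⟨pow_ne_zero d hp.ne_zero⟩
  tfae_have 1 → 2 := fun h => exists_equiv_of_bijective_of_injective π h.1 h.2
  tfae_have 2 → 1 := fun ⟨e, he⟩ =>
    ⟨map_one_bijective_of_equiv π e he, map_two_injective_of_equiv π hG₂ e he⟩
  tfae_have 1 → 3 := fun h => (pullback (ZMod (p ^ d)) π).hull_bijective h.1 h.2
  -- Pullback is contravariant: the target of the morphism is `H^*(G₁)`, the algebra assumed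
  -- quadratic.
  tfae_have 3 → 4 := fun h => (pullback (ZMod (p ^ d)) π).dec_bijective hG₁ h
  tfae_have 4 → 1 := fun h => ⟨(pullback (ZMod (p ^ d)) π).bijective_of_dec_bijective h,
    (pullback (ZMod (p ^ d)) π).injective_of_dec_injective h.1 hG₂⟩
  tfae_finish
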